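/- **Setting.** There are $n$ agents. An allocation is a vector $x\in\{0,1\}^n$, where $x_i$ indicates whether agent $i$ is served, and $c:\{0,1\}^n\to\mathbb R\cup\{+\infty\}$ is an arbitrary cost function. The welfare of $x$ at a valuation profile $v\in\mathbb R_{\ge0}^n$ is $\sum_i v_ix_i-c(x)$, and $\mathrm{OPT}(v)$ is its maximum over $x$. The values are drawn from a product distribution $F=F_1\times\dots\times F_n$ on $[0,\infty)^n$ with finite means. A (possibly randomized) algorithm $\mathcal A$ maps profiles, measurably, to random allocations; $\mathcal A(v)$ is its expected welfare at $v$, and $x_i(b)$ is the probability that agent $i$ is served when bidding $b$ while $v_{-i}\sim F_{-i}$. For $\beta>0$, $\mathcal A$ is a *worst-case $\beta$-approximation* for $c$ if $\mathcal A(v)\ge \mathrm{OPT}(v)/\beta$ for all $v\in\mathbb R_{\ge0}^n$, and a *Bayesian $\beta$-approximation* for $c$ if $\mathbb E_{v\sim F}[\mathcal A(v)]\ge\mathbb E_{v\sim F}[\mathrm{OPT}(v)]/\beta$. A mechanism is an allocation rule (an algorithm) together with a payment rule; $p_i(b)$ denotes the expected payment of agent $i$ when bidding $b$ while $v_{-i}\sim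 F_{-i}$. It is *BIC* if for every $i$ and $F_i$-almost every $v$ we have $v\,x_i(v)-p_i(v)\ge v\,x_i(b)-p_i(b)$ for all bids $b\in\mathbb R$, the expected payments $p_i(b)$ being well defined. **Ironed algorithm.** For each $i$ let $F_i^{-1}(q)=\inf\{v: q\le F_i(v)\}$, let $G_i(q)=\int_0^q x_i(F_i^{-1}(z))\,dz$ for $q\in[0,1]$, let $\bar G_i$ be the greatest convex minorant of $G_i$ on $[0,1]$, and let $q_i(v)=\tfrac12(F_i(v^-)+F_i(v))$ (which is $F_i(v)$ if $F_i$ is continuous). A monotonizing interval of agent $i$ is a set $\{v:q_i(v)\in J\}$, where $J$ is a maximal interval of $\{q:\bar G_i(q)<G_i(q)\}$. On input $v$, the ironed algorithm $\bar{\mathcal A}$ independently replaces each $v_i$ that lies in a monotonizing interval $I$ by a fresh draw from $F_i$ conditioned on $I$, leaves the other $v_i$ unchanged, and runs $\mathcal A$ on the result. **Corollary (ideal model, general costs).** Let $F$ be as above and let $\mathcal A$ be any algorithm. There is a mechanism $M$, depending only on $\mathcal A$ and $F$ (not on $c$ or $\beta$), such that: 1. The allocation rule of $M$ is the ironed algorithm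 $\bar{\mathcal A}$, up to null sets of bids: its outcome on $v$ is that of $\bar{\mathcal A}$ on $(r_1(v_1),\dots,r_n(v_n))$, for some measurable $r_i:\mathbb R\to\mathbb R$ with $r_i(b)=b$ for $F_i$-almost every $b$. 2. $M$ is BIC. Moreover, for each $i$ there is a nondecreasing $h_i:\mathbb R\to[0,1]$ such that, for $F_i$-almost every $v$, the allocation probability and expected payment of agent $i$ in $M$ are $x_i(v)=h_i(v)$ and $p_i(v)=v\,h_i(v)-\int_0^v h_i(z)\,dz$. 3. For every cost function $c$ and every $\beta>0$: if $\mathcal A$ is a worst-case $\beta$-approximation for $c$, then the allocation rule of $M$ is a Bayesian $\beta$-approximation for $c$. -/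

import Mathlib

open MeasureTheory ProbabilityTheory Set

noncomputable section

namespace SingleParam

/-- Valuation profiles `v = (v₁, …, vₙ)`. -/
abbrev Profile (n : ℕ) : Type := Fin n → ℝ

/-- Allocations `x = (x₁, …, xₙ)`; `x i = true` means that agent `i` is served. -/
abbrev Alloc (n : ℕ) : Type := Fin n → Bool

/-- A (possibly randomized) algorithm maps each valuation profile, measurably, to the law of the
chosen allocation.  It is used together with `[IsMarkovKernel A]`. -/
abbrev Algorithm (n : ℕ) : Type := Kernel (Profile n) (Alloc n)

/-! ### Welfare and approximation.  Costs take values in `ℝ ∪ {+∞}`. -/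

/-- Social welfare `∑ᵢ vᵢ xᵢ - c(x)` of allocation `x`; it is `-∞` when `c x = +∞`. -/
def allocWelfare {n : ℕ} (c : Alloc n → EReal) (v : Profile n) (x : Alloc n) : EReal :=
  ((∑ i, if x i = true then v i else 0 : ℝ) : EReal) - c x

/-- `OPT(v)`, the maximum social welfare. -/
def opt {n : ℕ} (c : Alloc n → EReal) (v : Profile n) : EReal :=
  ⨆ x : Alloc n, allocWelfare c v x

/-- `A(v)`, the expected welfare on profile `v` over the randomness of the algorithm
(in `EReal`, `0 * ⊥ = 0`, so allocations of probability zero do not contribute). -/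
def algWelfare {n : ℕ} (c : Alloc n → EReal) (A : Algorithm n) (v : Profile n) : EReal :=
  ∑ x : Alloc n, (((A v).real {x} : ℝ) : EReal) * allocWelfare c v x

/-- Expectation of an extended-real function: integral of the positive part minus integral of the
negative part. -/
def expectation {Ω : Type*} [MeasurableSpace Ω] (μ : Measure Ω) (f : Ω → EReal) : EReal :=
  ((∫⁻ ω, (f ω).toENNReal ∂μ : ENNReal) : EReal) - ((∫⁻ ω, (-f ω).toENNReal ∂μ : ENNReal) : EReal)

/-- `A(v) ≥ OPT(v) / β` for all (nonnegative) valuation profiles `v`. -/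
def IsWorstCaseApprox {n : ℕ} (c : Alloc n → EReal) (β : ℝ) (A : Algorithm n) : Prop :=
  ∀ v : Profile n, (∀ i, 0 ≤ v i) → opt c v / (β : EReal) ≤ algWelfare c A v

/-- `E[A(v)] ≥ E[OPT(v)] / β` for `v` drawn from the product distribution `F₁ × ⋯ × Fₙ`. -/
def IsBayesianApprox {n : ℕ} (c : Alloc n → EReal) (F : Fin n → Measure ℝ) (β : ℝ)
    (A : Algorithm n) : Prop :=
  expectation (Measure.pi F) (opt c) / (β : EReal) ≤ expectation (Measure.pi F) (algWelfare c A)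

/-! ### Mechanisms and incentives -/

/-- A mechanism: an allocation rule, and for every profile of bids the payment of each agent
(its expectation over the mechanism's randomness; agents are risk neutral). -/
structure Mechanism (n : ℕ) where
  alloc : Algorithm n
  pay : Profile n → Fin n → ℝ

/-- `xᵢ(b)`: the probability that agent `i` is served when bidding `b`, the other agents' bids being
drawn from their distributions. -/
def interimAlloc {n : ℕ} (F : Fin n → Measure ℝ) (A : Algorithm n) (i : Fin n) (b : ℝ) : ℝ :=
  ∫ v, (A (Function.update v i b)).real {x | x i = true} ∂(Measure.pi F)

/-- `pᵢ(b)`: the expected payment of agent `i` when bidding `b`, the other agents' bids being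
drawn from their distributions. -/
def interimPay {n : ℕ} (F : Fin n → Measure ℝ) (M : Mechanism n) (i : Fin n) (b : ℝ) : ℝ :=
  ∫ v, M.pay (Function.update v i b) i ∂(Measure.pi F)

/-- Bayesian incentive compatibility: when the others bid truthfully, then for almost every value
`v` of agent `i`, bidding `v` is a best response among all bids `b`.  Expected payments are required
to be well defined at every bid. -/
def IsBIC {n : ℕ} (F : Fin n → Measure ℝ) (M : Mechanism n) : Prop :=
  ∀ i : Fin n,
    (∀ b : ℝ, Integrable (fun v => M.pay (Function.update v i b) i) (Measure.pi F)) ∧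
    ∀ᵐ v ∂(F i), ∀ b : ℝ,
      v * interimAlloc F M.alloc i b - interimPay F M i b
        ≤ v * interimAlloc F M.alloc i v - interimPay F M i v

/-- Up to a null set of values, each interim allocation rule is a nondecreasing function `h` and the
interim payments are given by the payment identity `p(v) = v h(v) - ∫₀ᵛ h(z) dz`. -/
def IsMonotoneWithPaymentIdentity {n : ℕ} (F : Fin n → Measure ℝ) (M : Mechanism n) : Prop :=
  ∀ i : Fin n, ∃ h : ℝ → ℝ, Monotone h ∧ (∀ z, h z ∈ Icc (0 : ℝ) 1) ∧
    ∀ᵐ v ∂(F i), interimAlloc F M.alloc i v = h v ∧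
      interimPay F M i v = v * h v - ∫ z in (0 : ℝ)..v, h z

/-! ### Ironing -/

/-- The quantile function `F⁻¹(q) = inf {v | q ≤ F(v)}` (only used for `0 < q < 1`). -/
def quantile (μ : Measure ℝ) (q : ℝ) : ℝ :=
  sInf {v : ℝ | q ≤ μ.real (Iic v)}

/-- The quantile of a value `v`.  This is `F(v)` if `v` is not an atom; an atom occupies the
interval `[F(v-), F(v)]` of quantiles and is represented by its midpoint. -/
def quantileOf (μ : Measure ℝ) (v : ℝ) : ℝ :=
  (μ.real (Iio v) + μ.real (Iic v)) / 2

/-- The cumulative allocation rule in probability space, `G(q) = ∫₀^q x(F⁻¹(z)) dz`. -/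
def cumAlloc (μ : Measure ℝ) (x : ℝ → ℝ) (q : ℝ) : ℝ :=
  ∫ z in (0 : ℝ)..q, x (quantile μ z)

/-- The convex hull of the curve `G` on `[0, 1]`: its greatest convex minorant. -/
def convexHullCurve (G : ℝ → ℝ) (q : ℝ) : ℝ :=
  sSup ((fun φ : ℝ → ℝ => φ q) ''
    {φ | ConvexOn ℝ (Icc (0 : ℝ) 1) φ ∧ ∀ z ∈ Icc (0 : ℝ) 1, φ z ≤ G z})

/-- The quantiles at which the curve lies strictly above its convex hull. -/
def ironedQuantiles (μ : Measure ℝ) (x : ℝ → ℝ) : Set ℝ :=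
  {q | q ∈ Icc (0 : ℝ) 1 ∧ convexHullCurve (cumAlloc μ x) q < cumAlloc μ x q}

/-- The monotonizing interval of values that contains `v`: the values whose quantile lies in
the same maximal interval of `ironedQuantiles` as that of `v` (empty if there is none). -/
def monotonizingInterval (μ : Measure ℝ) (x : ℝ → ℝ) (v : ℝ) : Set ℝ :=
  {w | quantileOf μ w ∈ ordConnectedComponent (ironedQuantiles μ x) (quantileOf μ v)}

open Classical in
/-- Law of the redrawn value: if `v` lies in a monotonizing interval `I`, redraw from `μ`
conditioned on `I`; otherwise keep `v`. -/
def redraw (μ : Measure ℝ) (x : ℝ → ℝ) (v : ℝ) : Measure ℝ :=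
  if quantileOf μ v ∈ ironedQuantiles μ x then μ[|monotonizingInterval μ x v]
  else Measure.dirac v

/-- Law of the outcome of the ironed algorithm on profile `v`: redraw each agent's value
independently, using the monotonizing intervals of that agent's interim allocation rule under `A`,
and run `A` on the redrawn profile. -/
def ironedOutcome {n : ℕ} (F : Fin n → Measure ℝ) (A : Algorithm n) (v : Profile n) :
    Measure (Alloc n) :=
  (Measure.pi fun i => redraw (F i) (interimAlloc F A i) (v i)).bind A

/-- `B` is the ironed algorithm for `A`, up to null sets of bids: each bid `b` of agent `i` is first
replaced by `r i b`, which differs from `b` only on an `F i`-null set. -/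
def IsIroningOf {n : ℕ} (F : Fin n → Measure ℝ) (A B : Algorithm n) : Prop :=
  ∃ r : Fin n → ℝ → ℝ, (∀ i, Measurable (r i)) ∧ (∀ i, ∀ᵐ b ∂(F i), r i b = b) ∧
    ∀ v : Profile n, B v = ironedOutcome F A (fun i => r i (v i))

end SingleParam

end

/-! In quantile coordinates each agent's interim allocation becomes a function on (0, 1) with
primitive G, since the quantile function pushes the uniform law to `F i` (`map_quantile`). On a
component (a, b) of the set where the convex hull lies strictly below G, the hull is the chord of G,
whose slope is the mean of x over the redrawn interval. Elsewhere the hull touches G from below and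
so shares its derivative wherever G has one. Hence the interim allocation after redrawing is almost
everywhere the derivative of a convex function (`ae_hasDerivAt_hull`), and so agrees almost
everywhere with a monotone h.

Redrawing preserves each `F i` (`bind_redraw`). The redrawn profile therefore has the original law,
which has two consequences. Each agent faces the same opponents as before, so ironing one agent does
not disturb the interim rule of another (`ofReal_interimAlloc_of_bind`). The ex-ante law of the
outcome, and with it the expected cost, is unchanged, whatever the cost function is. Only the value
of the served agents changes, and it can only grow: the hull lies below G and the total allocation
is the same, so every upper tail {v > t} receives at least as much allocation as before, and
integrating over t ≥ 0 compares E[v x(v)] (`integral_mul_le_integral_mul_ironedAlloc`). Averaging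
the worst-case guarantee of A then gives the Bayesian one.

Monotonicity holds only off a null set, while BIC quantifies over all bids. Each bid is therefore
first retracted onto the full-measure set where the ironed allocation equals h, and is charged by
the payment identity for h at the retracted bid. -/

namespace SingleParam

/-! ### The quantile transform -/

/-- The uniform distribution on `(0, 1)`. -/
noncomputable abbrev unif : Measure ℝ := volume.restrict (Ioo 0 1)

instance : IsProbabilityMeasure unif := ⟨by simp⟩

/-- The infimum defining the quantile is attained because the cdf is right continuous; for 0 < q < 1
the set is nonempty and bounded below. This Galois connection drives the whole transform. -/
theorem quantile_le_iff (μ : Measure ℝ) [IsProbabilityMeasure μ] {q : ℝ} (hq : q ∈ Ioo (0 : ℝ) 1)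
    (v : ℝ) : quantile μ q ≤ v ↔ q ≤ μ.real (Iic v) := by
  have hset : {w : ℝ | q ≤ μ.real (Iic w)} = {w | q ≤ cdf μ w} := by
    simp only [cdf_eq_real]
  rw [quantile, hset, ← cdf_eq_real]
  have hne : {w | q ≤ cdf μ w}.Nonempty :=
    ((tendsto_cdf_atTop μ).eventually (eventually_ge_nhds hq.2)).exists
  have hbdd : BddBelow {w | q ≤ cdf μ w} := by
    obtain ⟨w, hw⟩ := ((tendsto_cdf_atBot μ).eventually (eventually_lt_nhds hq.1)).exists
    refine ⟨w, fun v hv => ?_⟩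
    by_contra! h
    exact absurd (hv.trans (monotone_cdf μ h.le)) (not_le.2 hw)
  refine ⟨fun h => ?_, fun h => csInf_le hbdd h⟩
  have hright : Filter.Tendsto (cdf μ) (nhdsWithin (sInf {w | q ≤ cdf μ w}) (Ioi _))
      (nhds (cdf μ (sInf {w | q ≤ cdf μ w}))) :=
    ((cdf μ).right_continuous _).mono Ioi_subset_Ici_self
  refine le_trans (ge_of_tendsto hright ?_) (monotone_cdf μ h)
  filter_upwards [self_mem_nhdsWithin] with w hw
  obtain ⟨s, hs, hsw⟩ := exists_lt_of_csInf_lt hne hw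
  exact hs.trans (monotone_cdf μ hsw.le)

theorem monotoneOn_quantile (μ : Measure ℝ) [IsProbabilityMeasure μ] :
    MonotoneOn (quantile μ) (Ioo 0 1) := fun _ ha _ hb hab =>
  (quantile_le_iff μ ha _).2 (hab.trans ((quantile_le_iff μ hb _).1 le_rfl))

theorem aemeasurable_quantile (μ : Measure ℝ) [IsProbabilityMeasure μ] :
    AEMeasurable (quantile μ) unif :=
  aemeasurable_restrict_of_monotoneOn measurableSet_Ioo (monotoneOn_quantile μ)

theorem map_quantile (μ : Measure ℝ) [IsProbabilityMeasure μ] : unif.map (quantile μ) = μ := by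
  have : IsProbabilityMeasure (unif.map (quantile μ)) :=
    Measure.isProbabilityMeasure_map (aemeasurable_quantile μ)
  refine Measure.ext_of_Iic _ _ fun v => ?_
  rw [Measure.map_apply_of_aemeasurable (aemeasurable_quantile μ) measurableSet_Iic]
  have h1 : unif (quantile μ ⁻¹' Iic v) = unif (Iic (μ.real (Iic v))) := by
    refine measure_congr ?_
    filter_upwards [ae_restrict_mem measurableSet_Ioo] with q hq
    exact propext (quantile_le_iff μ hq v)
  have h2 : unif (Iic (μ.real (Iic v))) = volume (Ioc 0 (μ.real (Iic v))) := by
    rw [Measure.restrict_apply measurableSet_Iic]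
    refine measure_congr ?_
    have := measureReal_le_one (μ := μ) (s := Iic v)
    filter_upwards [(Ioo_ae_eq_Ioc (a := (0 : ℝ)) (b := 1) (μ := volume))] with q hq
    have hq' : (q ∈ Ioo (0 : ℝ) 1) = (q ∈ Ioc (0 : ℝ) 1) := hq
    refine propext ?_
    change q ∈ Iic (μ.real (Iic v)) ∧ q ∈ Ioo (0 : ℝ) 1 ↔ q ∈ Ioc 0 (μ.real (Iic v))
    rw [hq']
    simp only [mem_Iic, mem_Ioc]
    constructor
    · rintro ⟨h, h', -⟩; exact ⟨h', h⟩
    · rintro ⟨h, h'⟩; exact ⟨h', h, h'.trans this⟩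
  rw [h1, h2, Real.volume_Ioc, sub_zero, ofReal_measureReal]

theorem monotone_quantileOf (μ : Measure ℝ) [IsProbabilityMeasure μ] :
    Monotone (quantileOf μ) := fun a b hab => by
  have h1 := measureReal_mono (μ := μ) (Iio_subset_Iio hab)
  have h2 := measureReal_mono (μ := μ) (Iic_subset_Iic.2 hab)
  simp only [quantileOf]
  linarith

theorem measurable_quantileOf (μ : Measure ℝ) [IsProbabilityMeasure μ] :
    Measurable (quantileOf μ) := (monotone_quantileOf μ).measurable

theorem le_measureReal_Iic_quantile (μ : Measure ℝ) [IsProbabilityMeasure μ] {q : ℝ}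
    (hq : q ∈ Ioo (0 : ℝ) 1) : q ≤ μ.real (Iic (quantile μ q)) :=
  (quantile_le_iff μ hq _).1 le_rfl

/-- A quantile strictly below that of q comes from some z < q, so the event pulls back into (0, q).
-/
theorem measureReal_Iio_quantile_le (μ : Measure ℝ) [IsProbabilityMeasure μ] {q : ℝ}
    (hq : q ∈ Ioo (0 : ℝ) 1) : μ.real (Iio (quantile μ q)) ≤ q := by
  have h : μ (Iio (quantile μ q)) ≤ ENNReal.ofReal q := by
    have h0 : μ (Iio (quantile μ q)) = unif.map (quantile μ) (Iio (quantile μ q)) := by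
      rw [map_quantile μ]
    rw [h0, Measure.map_apply_of_aemeasurable (aemeasurable_quantile μ) measurableSet_Iio]
    calc unif (quantile μ ⁻¹' Iio (quantile μ q)) ≤ volume (Ioo 0 q) := by
          rw [Measure.restrict_apply' measurableSet_Ioo]
          refine measure_mono ?_
          rintro z ⟨hz, hz'⟩
          refine ⟨hz'.1, ?_⟩
          by_contra! hle
          exact absurd (monotoneOn_quantile μ hq hz' hle) (not_le.2 hz)
      _ = ENNReal.ofReal q := by simp
  exact ENNReal.toReal_le_of_le_ofReal hq.1.le h

/-! ### Atoms and their quantile intervals -/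

theorem quantile_eq_of_mem_Ioo (μ : Measure ℝ) [IsProbabilityMeasure μ] {v z : ℝ}
    (hz : z ∈ Ioo (μ.real (Iio v)) (μ.real (Iic v))) : quantile μ z = v := by
  have hz' : z ∈ Ioo (0 : ℝ) 1 :=
    ⟨measureReal_nonneg.trans_lt hz.1, hz.2.trans_le measureReal_le_one⟩
  refine le_antisymm ((quantile_le_iff μ hz' v).2 hz.2.le) ?_
  by_contra! h
  have h1 := (quantile_le_iff μ hz' _).1 le_rfl
  have h2 : μ.real (Iic (quantile μ z)) ≤ μ.real (Iio v) :=
    measureReal_mono (Iic_subset_Iio.2 h)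
  linarith [hz.1]

/-- A quantile is represented by itself or by the midpoint of the atom that it belongs to. -/
def IsRepresented (μ : Measure ℝ) (q : ℝ) : Prop :=
  quantileOf μ (quantile μ q) = q ∨
    q ∈ Ioo (μ.real (Iio (quantile μ q))) (μ.real (Iic (quantile μ q)))

theorem countable_atoms (μ : Measure ℝ) [IsProbabilityMeasure μ] :
    {v : ℝ | 0 < μ {v}}.Countable := by
  simpa using Measure.countable_meas_level_set_pos (μ := μ) (g := fun v : ℝ => v) measurable_id

/-- The only exceptions are endpoints of atom intervals, and there are countably many atoms. At a
value that is not an atom the left and right limits of the cdf coincide, and both equal q. -/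
theorem ae_isRepresented (μ : Measure ℝ) [IsProbabilityMeasure μ] :
    ∀ᵐ q ∂unif, IsRepresented μ q := by
  have hc : ((fun v => μ.real (Iio v)) '' {v : ℝ | 0 < μ {v}} ∪
      (fun v => μ.real (Iic v)) '' {v : ℝ | 0 < μ {v}}).Countable :=
    ((countable_atoms μ).image _).union ((countable_atoms μ).image _)
  filter_upwards [ae_restrict_mem measurableSet_Ioo,
    ae_restrict_of_ae (hc.ae_notMem (μ := volume))] with q hq hqc
  have h1 := le_measureReal_Iic_quantile μ hq
  have h2 := measureReal_Iio_quantile_le μ hq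
  by_cases hv : 0 < μ {quantile μ q}
  · refine Or.inr ⟨lt_of_le_of_ne h2 fun h => ?_, lt_of_le_of_ne h1 fun h => ?_⟩
    · exact hqc (Or.inl ⟨_, hv, h⟩)
    · exact hqc (Or.inr ⟨_, hv, h.symm⟩)
  · refine Or.inl ?_
    have h3 : μ.real (Iic (quantile μ q)) = μ.real (Iio (quantile μ q)) := by
      have : (Iio (quantile μ q)) =ᵐ[μ] Iic (quantile μ q) :=
        Iio_ae_eq_Iic' (by simpa using hv)
      exact (measureReal_congr this).symm
    simp only [quantileOf]
    linarith

theorem quantileOf_mem_Ioo {μ : Measure ℝ} {v : ℝ} (h : μ.real (Iio v) < μ.real (Iic v)) :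
    quantileOf μ v ∈ Ioo (μ.real (Iio v)) (μ.real (Iic v)) := by
  simp only [quantileOf]
  constructor <;> linarith

section ConvexHull

/-! ### The convex hull of a curve -/

variable {G : ℝ → ℝ}

theorem convexHullCurve_le (h : ∃ φ : ℝ → ℝ, ConvexOn ℝ (Icc (0 : ℝ) 1) φ ∧
    ∀ z ∈ Icc (0 : ℝ) 1, φ z ≤ G z) {q : ℝ} (hq : q ∈ Icc (0 : ℝ) 1) :
    convexHullCurve G q ≤ G q := by
  obtain ⟨φ, hφ⟩ := h
  refine csSup_le ⟨_, φ, hφ, rfl⟩ ?_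
  rintro _ ⟨ψ, hψ, rfl⟩
  exact hψ.2 q hq

theorem le_convexHullCurve {φ : ℝ → ℝ} (hφ : ConvexOn ℝ (Icc (0 : ℝ) 1) φ)
    (hφG : ∀ z ∈ Icc (0 : ℝ) 1, φ z ≤ G z) {q : ℝ} (hq : q ∈ Icc (0 : ℝ) 1) :
    φ q ≤ convexHullCurve G q := by
  refine le_csSup ⟨G q, ?_⟩ ⟨φ, ⟨hφ, hφG⟩, rfl⟩
  rintro _ ⟨ψ, hψ, rfl⟩
  exact hψ.2 q hq

theorem convexOn_convexHullCurve (h : ∃ φ : ℝ → ℝ, ConvexOn ℝ (Icc (0 : ℝ) 1) φ ∧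
    ∀ z ∈ Icc (0 : ℝ) 1, φ z ≤ G z) : ConvexOn ℝ (Icc (0 : ℝ) 1) (convexHullCurve G) := by
  obtain ⟨φ₀, hφ₀⟩ := h
  refine ⟨convex_Icc 0 1, fun a ha b hb s t hs ht hst => ?_⟩
  refine csSup_le ⟨_, φ₀, hφ₀, rfl⟩ ?_
  rintro _ ⟨φ, hφ, rfl⟩
  refine (hφ.1.2 ha hb hs ht hst).trans ?_
  simp only [smul_eq_mul]
  gcongr
  · exact le_convexHullCurve hφ.1 hφ.2 ha
  · exact le_convexHullCurve hφ.1 hφ.2 hb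

theorem convexOn_affine (m c : ℝ) (s : Set ℝ) (hs : Convex ℝ s) :
    ConvexOn ℝ s fun z => c + m * z := by
  refine ⟨hs, fun a _ b _ u w _ _ huw => le_of_eq ?_⟩
  simp only [smul_eq_mul]
  linear_combination (-c) * huw

/-- A differentiable curve that touches a convex minorant has a tangent below the minorant. -/
theorem tangent_le_of_convexOn {H : ℝ → ℝ} (hH : ConvexOn ℝ (Icc (0 : ℝ) 1) H)
    (hHG : ∀ z ∈ Icc (0 : ℝ) 1, H z ≤ G z) {q g : ℝ} (hq : q ∈ Ioo (0 : ℝ) 1) (heq : H q = G q)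
    (hg : HasDerivAt G g q) {y : ℝ} (hy : y ∈ Icc (0 : ℝ) 1) : G q + g * (y - q) ≤ H y := by
  have hq' : q ∈ Icc (0 : ℝ) 1 := Ioo_subset_Icc_self hq
  have hslope := hasDerivAt_iff_tendsto_slope.1 hg
  rcases lt_trichotomy y q with hyq | rfl | hyq
  · have h : slope H q y ≤ g := by
      -- By convexity the slope of H on [y, q] is at most its slope on [q, z], which is at most that
      -- of G because H ≤ G with equality at q. Then z decreases to q.
      refine ge_of_tendsto (hslope.mono_left (nhdsWithin_mono q (s := Ioi q) fun z hz => (mem_Ioi.1 hz).ne')) ?_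
      filter_upwards [self_mem_nhdsWithin, nhdsWithin_le_nhds (Ioo_mem_nhds hq.1 hq.2)] with z hz hz'
      have hz1 : z ∈ Icc (0 : ℝ) 1 := Ioo_subset_Icc_self hz'
      have h1 : slope H y q ≤ slope H q z := by
        simpa only [slope_def_field] using hH.slope_mono_adjacent hy hz1 hyq hz
      rw [slope_comm]
      refine h1.trans ?_
      rw [slope_def_field, slope_def_field]
      have := hHG z hz1
      have hz0 : 0 < z - q := sub_pos.2 hz
      gcongr
      exact heq.ge
    rw [slope_def_field, div_le_iff_of_neg (by linarith)] at h
    linarith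
  · simp [heq]
  · have h : g ≤ slope H q y := by
      refine le_of_tendsto (hslope.mono_left (nhdsWithin_mono q (s := Iio q) fun z hz => (mem_Iio.1 hz).ne)) ?_
      filter_upwards [self_mem_nhdsWithin, nhdsWithin_le_nhds (Ioo_mem_nhds hq.1 hq.2)] with z hz hz'
      have hz1 : z ∈ Icc (0 : ℝ) 1 := Ioo_subset_Icc_self hz'
      have h1 : slope H z q ≤ slope H q y := by
        simpa only [slope_def_field] using hH.slope_mono_adjacent hz1 hy hz hyq
      refine le_trans ?_ h1
      rw [slope_comm, slope_def_field, slope_def_field]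
      have := hHG z hz1
      have hz0 : 0 < q - z := sub_pos.2 hz
      gcongr
      exact heq.ge
    rw [slope_def_field, le_div_iff₀ (by linarith)] at h
    linarith

/-- H is squeezed between G and the tangent of G at q, so its linearization error is at most that of
G. -/
theorem hasDerivAt_of_convexOn_of_touch {H : ℝ → ℝ} (hH : ConvexOn ℝ (Icc (0 : ℝ) 1) H)
    (hHG : ∀ z ∈ Icc (0 : ℝ) 1, H z ≤ G z) {q g : ℝ} (hq : q ∈ Ioo (0 : ℝ) 1) (heq : H q = G q)
    (hg : HasDerivAt G g q) : HasDerivAt H g q := by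
  rw [hasDerivAt_iff_isLittleO] at hg ⊢
  refine Asymptotics.IsBigO.trans_isLittleO (Asymptotics.IsBigO.of_bound 1 ?_) hg
  filter_upwards [Ioo_mem_nhds hq.1 hq.2] with y hy
  have hy' := Ioo_subset_Icc_self hy
  have h1 := tangent_le_of_convexOn hH hHG hq heq (hasDerivAt_iff_isLittleO.2 hg) hy'
  have h2 := hHG y hy'
  simp only [smul_eq_mul, Real.norm_eq_abs, one_mul]
  rw [abs_of_nonneg (by linarith), abs_of_nonneg (by linarith)]
  linarith

/-- Where the hull lies strictly below a continuous curve, it is the chord of the curve. -/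
theorem convexHullCurve_eq_chord (h : ∃ φ : ℝ → ℝ, ConvexOn ℝ (Icc (0 : ℝ) 1) φ ∧
    ∀ z ∈ Icc (0 : ℝ) 1, φ z ≤ G z) {a b : ℝ} (hG : ContinuousOn G (Icc a b)) (ha : 0 ≤ a) (hab : a < b)
    (hb : b ≤ 1) (hGa : convexHullCurve G a = G a) (hGb : convexHullCurve G b = G b)
    (hlt : ∀ z ∈ Ioo a b, convexHullCurve G z < G z) {q : ℝ} (hq : q ∈ Icc a b) :
    convexHullCurve G q = G a + (G b - G a) / (b - a) * (q - a) := by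
  set m := (G b - G a) / (b - a) with hm
  have hba : 0 < b - a := sub_pos.2 hab
  have hmb : m * (b - a) = G b - G a := by rw [hm]; field_simp
  have hconv := convexOn_convexHullCurve h
  have ha' : a ∈ Icc (0 : ℝ) 1 := ⟨ha, by linarith⟩
  have hb' : b ∈ Icc (0 : ℝ) 1 := ⟨by linarith, hb⟩
  have hq' : q ∈ Icc (0 : ℝ) 1 := ⟨by linarith [hq.1], by linarith [hq.2]⟩
  -- The lowest point p of G relative to the chord; the aim is to show that its depth d is zero.
  obtain ⟨p, hp, hmin⟩ := isCompact_Icc.exists_isMinOn (s := Icc a b)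
    (f := fun z => G z - (G a + m * (z - a))) ⟨a, le_rfl, hab.le⟩
    (by fun_prop)
  set d := G p - (G a + m * (p - a)) with hd
  have hda : d ≤ 0 := by
    have : d ≤ G a - (G a + m * (a - a)) := hmin (left_mem_Icc.2 hab.le)
    linarith
  -- Outside [a, b] a convex function lies above the extension of its chord.
  have houter : ∀ z ∈ Icc (0 : ℝ) 1, z ∉ Icc a b → G a + m * (z - a) ≤ convexHullCurve G z := by
    intro z hz hzab
    rcases lt_or_ge z a with hza | hza
    · have h1 := hconv.slope_mono_adjacent hz hb' hza hab
      rw [hGa, hGb, ← hm, div_le_iff₀ (by linarith)] at h1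
      linarith
    · have hzb : b < z := by
        by_contra! h'
        exact hzab ⟨hza, h'⟩
      have h1 := hconv.slope_mono_adjacent ha' hz hab hzb
      rw [hGa, hGb, ← hm, le_div_iff₀ (by linarith)] at h1
      linarith
  -- The maximum of the hull and the chord shifted by d is still a convex minorant of G, so the
  -- shifted chord lies below the hull.
  have hφ : ∀ z ∈ Icc (0 : ℝ) 1, d + (G a + m * (z - a)) ≤ convexHullCurve G z := by
    intro z hz
    have hc : ConvexOn ℝ (Icc (0 : ℝ) 1)
        (convexHullCurve G ⊔ fun z => (d + G a - m * a) + m * z) :=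
      hconv.sup (convexOn_affine _ _ _ (convex_Icc 0 1))
    have := le_convexHullCurve (G := G) hc (fun w hw => ?_) hz
    · exact le_trans (by simp only [Pi.sup_apply]; exact le_max_of_le_right (by linarith)) this
    · simp only [Pi.sup_apply]
      refine sup_le (convexHullCurve_le h hw) ?_
      by_cases hwab : w ∈ Icc a b
      · have h2 : d ≤ G w - (G a + m * (w - a)) := hmin hwab
        linarith
      · have h1 := houter w hw hwab
        have h2 := convexHullCurve_le h hw
        linarith
  -- At an interior p the shifted chord meets G, so the hull would touch G there, contrary to `hlt`.
  -- Thus p is an endpoint.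
  have hd0 : d = 0 := by
    have hp' : p ∈ Icc (0 : ℝ) 1 := ⟨by linarith [hp.1], by linarith [hp.2]⟩
    have h1 := hφ p hp'
    rcases eq_or_lt_of_le hp.1 with rfl | hpa
    · simp [hd]
    rcases eq_or_lt_of_le hp.2 with rfl | hpb
    · rw [hd]; linarith
    have h2 := hlt p ⟨hpa, hpb⟩
    linarith
  refine le_antisymm ?_ (by have := hφ q hq'; linarith)
  have := hconv.2 ha' hb' (div_nonneg (sub_nonneg.2 hq.2) hba.le)
    (div_nonneg (sub_nonneg.2 hq.1) hba.le) (by field_simp; ring)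
  have hcomb : (b - q) / (b - a) * a + (q - a) / (b - a) * b = q := by field_simp; ring
  simp only [smul_eq_mul, hcomb, hGa, hGb] at this
  refine this.trans (le_of_eq ?_)
  rw [hm]; field_simp; ring

end ConvexHull

section CumulativeAllocation

/-! ### The cumulative allocation curve and its hull -/

theorem exists_ordConnectedComponent_eq_Ioo {U : Set ℝ} (hU : IsOpen U) (hU1 : U ⊆ Ioo 0 1) {q : ℝ}
    (hq : q ∈ U) : ∃ a b : ℝ, 0 ≤ a ∧ a < b ∧ b ≤ 1 ∧ a ∉ U ∧ b ∉ U ∧ q ∈ Ioo a b ∧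
      ordConnectedComponent U q = Ioo a b := by
  set C := ordConnectedComponent U q with hC
  have hqC : q ∈ C := self_mem_ordConnectedComponent.2 hq
  have hCU : C ⊆ U := ordConnectedComponent_subset
  have hopen : IsOpen C := by
    rw [isOpen_iff_mem_nhds]
    intro y hy
    rw [hC, ordConnectedComponent_eq (mem_ordConnectedComponent.1 hy),
      ordConnectedComponent_mem_nhds]
    exact hU.mem_nhds (hCU hy)
  have hconn : IsConnected C := ⟨⟨q, hqC⟩, OrdConnected.isPreconnected inferInstance⟩
  have hbelow : BddBelow C := ⟨0, fun z hz => (hU1 (hCU hz)).1.le⟩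
  have habove : BddAbove C := ⟨1, fun z hz => (hU1 (hCU hz)).2.le⟩
  have hsub : Ioo (sInf C) (sSup C) ⊆ C := hconn.Ioo_csInf_csSup_subset hbelow habove
  have hsub' : C ⊆ Icc (sInf C) (sSup C) := subset_Icc_csInf_csSup hbelow habove
  have haC : sInf C ∉ C := fun h => by
    obtain ⟨z, hz, hzC⟩ := (Filter.eventually_mem_set.2 (hopen.mem_nhds h)).exists_lt
    exact absurd (csInf_le hbelow hzC) (not_le.2 hz)
  have hbC : sSup C ∉ C := fun h => by
    obtain ⟨z, hz, hzC⟩ := (Filter.eventually_mem_set.2 (hopen.mem_nhds h)).exists_gt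
    exact absurd (le_csSup habove hzC) (not_le.2 hz)
  have hCeq : C = Ioo (sInf C) (sSup C) := by
    refine Subset.antisymm (fun z hz => ⟨lt_of_le_of_ne (hsub' hz).1 ?_,
      lt_of_le_of_ne (hsub' hz).2 ?_⟩) hsub
    · rintro h; exact haC (h ▸ hz)
    · rintro h; exact hbC (h ▸ hz)
  have hqI : q ∈ Ioo (sInf C) (sSup C) := hCeq ▸ hqC
  refine ⟨sInf C, sSup C, le_csInf ⟨q, hqC⟩ fun z hz => (hU1 (hCU hz)).1.le, hqI.1.trans hqI.2,
    csSup_le ⟨q, hqC⟩ fun z hz => (hU1 (hCU hz)).2.le, fun h => haC ?_, fun h => hbC ?_, hqI, hCeq⟩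
  -- An endpoint lying in U would be joined to q inside U and so belong to the component.
  · rw [hC, mem_ordConnectedComponent, uIcc_of_ge hqI.1.le]
    rintro z ⟨hz1, hz2⟩
    rcases hz1.eq_or_lt with rfl | hz1
    · exact h
    · exact hCU (hsub ⟨hz1, hz2.trans_lt hqI.2⟩)
  · rw [hC, mem_ordConnectedComponent, uIcc_of_le hqI.2.le]
    rintro z ⟨hz1, hz2⟩
    rcases hz2.eq_or_lt with rfl | hz2
    · exact h
    · exact hCU (hsub ⟨hqI.1.trans_le hz1, hz2⟩)

theorem cumAlloc_zero {μ : Measure ℝ} {x : ℝ → ℝ} : cumAlloc μ x 0 = 0 := intervalIntegral.integral_same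

variable {μ : Measure ℝ} [IsProbabilityMeasure μ] {x : ℝ → ℝ}

theorem integrable_comp_quantile (hx : Measurable x) (h01 : ∀ v, x v ∈ Icc (0 : ℝ) 1) :
    Integrable (fun q => x (quantile μ q)) unif := by
  refine Integrable.of_mem_Icc 0 1 (hx.comp_aemeasurable (aemeasurable_quantile μ)) ?_
  exact Filter.Eventually.of_forall fun q => h01 _

theorem intervalIntegrable_comp_quantile (hx : Measurable x) (h01 : ∀ v, x v ∈ Icc (0 : ℝ) 1)
    {a b : ℝ} (ha : a ∈ Icc (0 : ℝ) 1) (hb : b ∈ Icc (0 : ℝ) 1) :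
    IntervalIntegrable (fun q => x (quantile μ q)) volume a b := by
  have h : IntegrableOn (fun q => x (quantile μ q)) (Icc 0 1) volume :=
    (integrableOn_Icc_iff_integrableOn_Ioo).2 (integrable_comp_quantile hx h01)
  rw [intervalIntegrable_iff]
  refine h.mono_set (uIoc_subset_uIcc.trans ?_)
  exact ordConnected_Icc.uIcc_subset ha hb

theorem cumAlloc_sub (hx : Measurable x) (h01 : ∀ v, x v ∈ Icc (0 : ℝ) 1) {a b : ℝ}
    (ha : a ∈ Icc (0 : ℝ) 1) (hb : b ∈ Icc (0 : ℝ) 1) :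
    cumAlloc μ x b - cumAlloc μ x a = ∫ z in a..b, x (quantile μ z) :=
  intervalIntegral.integral_interval_sub_left
    (intervalIntegrable_comp_quantile hx h01 (by simp) hb)
    (intervalIntegrable_comp_quantile hx h01 (by simp) ha)

theorem cumAlloc_sub_mem_Icc (hx : Measurable x) (h01 : ∀ v, x v ∈ Icc (0 : ℝ) 1) {a b : ℝ}
    (ha : a ∈ Icc (0 : ℝ) 1) (hb : b ∈ Icc (0 : ℝ) 1) (hab : a ≤ b) :
    cumAlloc μ x b - cumAlloc μ x a ∈ Icc 0 (b - a) := by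
  rw [cumAlloc_sub hx h01 ha hb]
  refine ⟨intervalIntegral.integral_nonneg hab fun z _ => (h01 _).1, ?_⟩
  calc ∫ z in a..b, x (quantile μ z) ≤ ∫ z in a..b, (1 : ℝ) :=
        intervalIntegral.integral_mono_on hab (intervalIntegrable_comp_quantile hx h01 ha hb)
          intervalIntegrable_const fun z _ => (h01 _).2
    _ = b - a := by simp

theorem continuousOn_cumAlloc (hx : Measurable x) (h01 : ∀ v, x v ∈ Icc (0 : ℝ) 1) :
    ContinuousOn (cumAlloc μ x) (Icc 0 1) := by
  have h := intervalIntegral.continuousOn_primitive_interval (μ := volume)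
    (f := fun z => x (quantile μ z)) (a := (0 : ℝ)) (b := 1) (by
      rw [uIcc_of_le zero_le_one]
      exact (integrableOn_Icc_iff_integrableOn_Ioo).2 (integrable_comp_quantile hx h01))
  rwa [uIcc_of_le zero_le_one] at h

theorem exists_convex_minorant (hx : Measurable x) (h01 : ∀ v, x v ∈ Icc (0 : ℝ) 1) :
    ∃ φ : ℝ → ℝ, ConvexOn ℝ (Icc (0 : ℝ) 1) φ ∧ ∀ z ∈ Icc (0 : ℝ) 1, φ z ≤ cumAlloc μ x z := by
  refine ⟨fun _ => 0, convexOn_const 0 (convex_Icc 0 1), fun z hz => ?_⟩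
  have := (cumAlloc_sub_mem_Icc (μ := μ) hx h01 (a := 0) (by simp) hz hz.1).1
  simpa [cumAlloc_zero] using this

/-- The hull of the cumulative allocation curve. -/
noncomputable abbrev hull (μ : Measure ℝ) (x : ℝ → ℝ) : ℝ → ℝ := convexHullCurve (cumAlloc μ x)

theorem convexOn_hull (hx : Measurable x) (h01 : ∀ v, x v ∈ Icc (0 : ℝ) 1) :
    ConvexOn ℝ (Icc (0 : ℝ) 1) (hull μ x) :=
  convexOn_convexHullCurve (exists_convex_minorant hx h01)

theorem hull_le (hx : Measurable x) (h01 : ∀ v, x v ∈ Icc (0 : ℝ) 1) {q : ℝ}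
    (hq : q ∈ Icc (0 : ℝ) 1) : hull μ x q ≤ cumAlloc μ x q :=
  convexHullCurve_le (exists_convex_minorant hx h01) hq

theorem hull_nonneg (hx : Measurable x) (h01 : ∀ v, x v ∈ Icc (0 : ℝ) 1) {q : ℝ}
    (hq : q ∈ Icc (0 : ℝ) 1) : 0 ≤ hull μ x q := by
  refine le_convexHullCurve (φ := fun _ => 0) (convexOn_const 0 (convex_Icc 0 1))
    (fun z hz => ?_) hq
  simpa [cumAlloc_zero] using
    (cumAlloc_sub_mem_Icc (μ := μ) hx h01 (a := 0) (by simp) hz hz.1).1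

/-- As x ≤ 1, the line of slope one through (1, G(1)) stays below G. It pins the hull to G at 1, as
`hull_nonneg` does at 0. -/
theorem le_hull (hx : Measurable x) (h01 : ∀ v, x v ∈ Icc (0 : ℝ) 1) {q : ℝ}
    (hq : q ∈ Icc (0 : ℝ) 1) : cumAlloc μ x 1 - 1 + q ≤ hull μ x q := by
  have := le_convexHullCurve (G := cumAlloc μ x)
    (convexOn_affine 1 (cumAlloc μ x 1 - 1) _ (convex_Icc (0 : ℝ) 1)) (fun z hz => ?_) hq
  · simpa using this
  · have := (cumAlloc_sub_mem_Icc (μ := μ) hx h01 hz (b := 1) (by simp) hz.2).2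
    linarith

theorem hull_eq_of_notMem (hx : Measurable x) (h01 : ∀ v, x v ∈ Icc (0 : ℝ) 1) {q : ℝ}
    (hq : q ∈ Icc (0 : ℝ) 1) (h : q ∉ ironedQuantiles μ x) : hull μ x q = cumAlloc μ x q :=
  le_antisymm (hull_le hx h01 hq) (not_lt.1 fun h' => h ⟨hq, h'⟩)

theorem ironedQuantiles_subset (hx : Measurable x) (h01 : ∀ v, x v ∈ Icc (0 : ℝ) 1) :
    ironedQuantiles μ x ⊆ Ioo 0 1 := by
  rintro q ⟨hq, hlt⟩
  refine ⟨lt_of_le_of_ne hq.1 ?_, lt_of_le_of_ne hq.2 ?_⟩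
  · rintro rfl
    have := hull_nonneg (μ := μ) hx h01 hq
    rw [cumAlloc_zero] at hlt
    exact absurd this (not_le.2 hlt)
  · rintro rfl
    have := le_hull (μ := μ) hx h01 hq
    linarith

theorem isOpen_ironedQuantiles (hx : Measurable x) (h01 : ∀ v, x v ∈ Icc (0 : ℝ) 1) :
    IsOpen (ironedQuantiles μ x) := by
  have hH : ContinuousOn (hull μ x) (Ioo 0 1) := by
    simpa using (convexOn_hull (μ := μ) hx h01).continuousOn_interior
  have hG := (continuousOn_cumAlloc (μ := μ) hx h01).mono Ioo_subset_Icc_self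
  have h : ironedQuantiles μ x =
      Ioo 0 1 ∩ (fun q => cumAlloc μ x q - hull μ x q) ⁻¹' Ioi 0 := by
    ext q
    constructor
    · intro hq
      exact ⟨ironedQuantiles_subset hx h01 hq, sub_pos.2 hq.2⟩
    · rintro ⟨hq, hlt⟩
      exact ⟨Ioo_subset_Icc_self hq, sub_pos.1 hlt⟩
  rw [h]
  exact (hG.sub hH).isOpen_inter_preimage isOpen_Ioo isOpen_Ioi

/-- Convexity gives continuity only in the interior. At each endpoint the hull is squeezed between G
and an affine minorant that meets G there. -/
theorem continuousOn_hull (hx : Measurable x) (h01 : ∀ v, x v ∈ Icc (0 : ℝ) 1) :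
    ContinuousOn (hull μ x) (Icc 0 1) := by
  have hint : ContinuousOn (hull μ x) (Ioo 0 1) := by
    simpa using (convexOn_hull (μ := μ) hx h01).continuousOn_interior
  have hG := continuousOn_cumAlloc (μ := μ) hx h01
  intro q hq
  rcases hq.1.eq_or_lt with rfl | h0
  · have h : hull μ x 0 = cumAlloc μ x 0 :=
      hull_eq_of_notMem hx h01 hq fun h => (ironedQuantiles_subset hx h01 h).1.false
    refine tendsto_of_tendsto_of_tendsto_of_le_of_le' tendsto_const_nhds
      (by rw [h]; exact hG 0 hq) ?_ ?_
    · filter_upwards [self_mem_nhdsWithin] with z hz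
      rw [h, cumAlloc_zero]; exact hull_nonneg hx h01 hz
    · filter_upwards [self_mem_nhdsWithin] with z hz using hull_le hx h01 hz
  rcases hq.2.eq_or_lt with rfl | h1
  · have h : hull μ x 1 = cumAlloc μ x 1 :=
      hull_eq_of_notMem hx h01 hq fun h => (ironedQuantiles_subset hx h01 h).2.false
    have hlow : Filter.Tendsto (fun q => cumAlloc μ x 1 - 1 + q) (nhdsWithin 1 (Icc 0 1))
        (nhds (hull μ x 1)) := by
      have : ContinuousWithinAt (fun q => cumAlloc μ x 1 - 1 + q) (Icc (0 : ℝ) 1) 1 := by fun_prop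
      simpa [ContinuousWithinAt, h] using this
    refine tendsto_of_tendsto_of_tendsto_of_le_of_le' hlow (by rw [h]; exact hG 1 hq) ?_ ?_
    · filter_upwards [self_mem_nhdsWithin] with z hz using le_hull hx h01 hz
    · filter_upwards [self_mem_nhdsWithin] with z hz using hull_le hx h01 hz
  · exact (hint.continuousAt (Ioo_mem_nhds h0 h1)).continuousWithinAt

theorem hasDerivAt_hull_of_component (hx : Measurable x) (h01 : ∀ v, x v ∈ Icc (0 : ℝ) 1)
    {a b : ℝ} (ha : 0 ≤ a) (hb : b ≤ 1) (haU : a ∉ ironedQuantiles μ x)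
    (hbU : b ∉ ironedQuantiles μ x) (hsub : Ioo a b ⊆ ironedQuantiles μ x) {q : ℝ}
    (hq : q ∈ Ioo a b) :
    HasDerivAt (hull μ x) ((cumAlloc μ x b - cumAlloc μ x a) / (b - a)) q := by
  have hab : a < b := hq.1.trans hq.2
  have h1 : HasDerivAt (fun z => cumAlloc μ x a +
      (cumAlloc μ x b - cumAlloc μ x a) / (b - a) * (z - a))
      ((cumAlloc μ x b - cumAlloc μ x a) / (b - a)) q := by
    simpa using (((hasDerivAt_id q).sub_const a).const_mul
      ((cumAlloc μ x b - cumAlloc μ x a) / (b - a))).const_add (cumAlloc μ x a)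
  refine h1.congr_of_eventuallyEq ?_
  filter_upwards [Ioo_mem_nhds hq.1 hq.2] with z hz
  exact convexHullCurve_eq_chord (exists_convex_minorant hx h01)
    ((continuousOn_cumAlloc hx h01).mono (Icc_subset_Icc ha hb)) ha hab hb
    (hull_eq_of_notMem hx h01 ⟨ha, by linarith⟩ haU)
    (hull_eq_of_notMem hx h01 ⟨by linarith, hb⟩ hbU) (fun w hw => (hsub hw).2)
    (Ioo_subset_Icc_self hz)

theorem ae_hasDerivAt_cumAlloc (hx : Measurable x) (h01 : ∀ v, x v ∈ Icc (0 : ℝ) 1) :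
    ∀ᵐ q ∂unif, HasDerivAt (cumAlloc μ x) (x (quantile μ q)) q := by
  have h := (intervalIntegrable_comp_quantile (μ := μ) hx h01 (a := 0) (b := 1)
    (by simp) (by simp)).ae_hasDerivAt_integral
  filter_upwards [ae_restrict_of_ae h, ae_restrict_mem measurableSet_Ioo] with q hq hq'
  rw [uIcc_of_le zero_le_one] at hq
  exact hq (Ioo_subset_Icc_self hq') 0 (by simp)

/-- The quantiles of an atom are either all ironed or all not. -/
theorem Ioo_atom_subset_or (hx : Measurable x) (h01 : ∀ v, x v ∈ Icc (0 : ℝ) 1) (v : ℝ) :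
    Ioo (μ.real (Iio v)) (μ.real (Iic v)) ⊆ ironedQuantiles μ x ∨
      Disjoint (Ioo (μ.real (Iio v)) (μ.real (Iic v))) (ironedQuantiles μ x) := by
  rw [or_iff_not_imp_left, not_subset]
  rintro ⟨z, hz, hzU⟩
  set s := μ.real (Iio v)
  set t := μ.real (Iic v)
  have hst : Ioo s t ⊆ Ioo 0 1 := Ioo_subset_Ioo measureReal_nonneg measureReal_le_one
  have hG : ∀ y ∈ Ioo s t, cumAlloc μ x y = cumAlloc μ x z + x v * (y - z) := by
    intro y hy
    rw [← sub_eq_iff_eq_add', cumAlloc_sub hx h01 (Ioo_subset_Icc_self (hst hz))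
      (Ioo_subset_Icc_self (hst hy))]
    rw [intervalIntegral.integral_congr (g := fun _ => x v)]
    · simp [mul_comm]
    · intro w hw
      have : w ∈ Ioo s t := ordConnected_Ioo.uIcc_subset hz hy hw
      simp only [quantile_eq_of_mem_Ioo μ this]
  have hder : HasDerivAt (cumAlloc μ x) (x v) z := by
    have h1 : HasDerivAt (fun y => cumAlloc μ x z + x v * (y - z)) (x v) z := by
      simpa using (((hasDerivAt_id z).sub_const z).const_mul (x v)).const_add (cumAlloc μ x z)
    refine h1.congr_of_eventuallyEq ?_
    filter_upwards [Ioo_mem_nhds hz.1 hz.2] with y hy using hG y hy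
  rw [Set.disjoint_left]
  intro y hy hyU
  -- G is affine on the interval of the atom, so its tangent at the unironed z is G itself there;
  -- lying below the hull, it leaves no point of the interval to be ironed.
  have h1 := tangent_le_of_convexOn (convexOn_hull hx h01) (fun _ => hull_le hx h01) (hst hz)
    (hull_eq_of_notMem hx h01 (Ioo_subset_Icc_self (hst hz)) hzU) hder hyU.1
  rw [← hG y hy] at h1
  exact absurd hyU.2 (not_lt.2 h1)

/-- The interval of an atom is connected and wholly ironed or wholly unironed, so its midpoint
stands for all its quantiles when components are compared. -/
theorem IsRepresented.mem_component_iff (hx : Measurable x) (h01 : ∀ v, x v ∈ Icc (0 : ℝ) 1)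
    {q : ℝ} (hq : IsRepresented μ q) (p : ℝ) :
    quantileOf μ (quantile μ q) ∈ ordConnectedComponent (ironedQuantiles μ x) p ↔
      q ∈ ordConnectedComponent (ironedQuantiles μ x) p := by
  rcases hq with hq | hq
  · rw [hq]
  have hm := quantileOf_mem_Ioo (hq.1.trans hq.2)
  rcases Ioo_atom_subset_or (μ := μ) hx h01 (quantile μ q) with h | h
  · have : uIcc (quantileOf μ (quantile μ q)) q ⊆ ironedQuantiles μ x :=
      (ordConnected_Ioo.uIcc_subset hm hq).trans h
    exact ⟨fun h' => mem_ordConnectedComponent_trans h' this,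
      fun h' => mem_ordConnectedComponent_trans h' (mem_ordConnectedComponent_comm.1 this)⟩
  · rw [Set.disjoint_left] at h
    exact ⟨fun h' => absurd (ordConnectedComponent_subset h') (h hm),
      fun h' => absurd (ordConnectedComponent_subset h') (h hq)⟩

theorem IsRepresented.mem_iff (hx : Measurable x) (h01 : ∀ v, x v ∈ Icc (0 : ℝ) 1)
    {q : ℝ} (hq : IsRepresented μ q) :
    quantileOf μ (quantile μ q) ∈ ironedQuantiles μ x ↔ q ∈ ironedQuantiles μ x := by
  constructor
  · intro h
    exact ordConnectedComponent_subset
      ((hq.mem_component_iff hx h01 _).1 (self_mem_ordConnectedComponent.2 h))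
  · intro h
    exact ordConnectedComponent_subset
      ((hq.mem_component_iff hx h01 _).2 (self_mem_ordConnectedComponent.2 h))

end CumulativeAllocation

section Redraw

/-! ### Redrawing a value -/

variable {μ : Measure ℝ} {x : ℝ → ℝ}

/-- The values whose quantile lies in the component of `p`. -/
def componentValues (μ : Measure ℝ) (x : ℝ → ℝ) (p : ℝ) : Set ℝ :=
  quantileOf μ ⁻¹' ordConnectedComponent (ironedQuantiles μ x) p

theorem redraw_of_mem {v : ℝ} (hv : quantileOf μ v ∈ ironedQuantiles μ x) :
    redraw μ x v = μ[|componentValues μ x (quantileOf μ v)] := if_pos hv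

theorem redraw_of_notMem {v : ℝ} (hv : quantileOf μ v ∉ ironedQuantiles μ x) :
    redraw μ x v = Measure.dirac v := if_neg hv

theorem componentValues_eq {p p' : ℝ} (h : p' ∈ ordConnectedComponent (ironedQuantiles μ x) p) :
    componentValues μ x p' = componentValues μ x p := by
  rw [componentValues, componentValues, ordConnectedComponent_eq (mem_ordConnectedComponent.1 h)]

theorem redraw_of_mem_componentValues {v p : ℝ} (hv : v ∈ componentValues μ x p) :
    redraw μ x v = μ[|componentValues μ x p] := by
  rw [redraw_of_mem (ordConnectedComponent_subset hv), componentValues_eq hv]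

/-- The interim allocation after redrawing. -/
noncomputable def ironedAlloc (μ : Measure ℝ) (x : ℝ → ℝ) (v : ℝ) : ℝ := ∫ w, x w ∂(redraw μ x v)

theorem ironedAlloc_of_notMem {v : ℝ} (hv : quantileOf μ v ∉ ironedQuantiles μ x) :
    ironedAlloc μ x v = x v := by
  rw [ironedAlloc, redraw_of_notMem hv, integral_dirac]

variable [IsProbabilityMeasure μ]

theorem measurableSet_componentValues (p : ℝ) : MeasurableSet (componentValues μ x p) :=
  measurable_quantileOf μ
    (OrdConnected.measurableSet (s := ordConnectedComponent (ironedQuantiles μ x) p) inferInstance)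

theorem quantile_preimage_componentValues (hx : Measurable x) (h01 : ∀ v, x v ∈ Icc (0 : ℝ) 1)
    (p : ℝ) : quantile μ ⁻¹' componentValues μ x p =ᵐ[unif]
      ordConnectedComponent (ironedQuantiles μ x) p := by
  filter_upwards [ae_isRepresented μ] with q hq
  exact propext (hq.mem_component_iff hx h01 p)

theorem measure_componentValues (hx : Measurable x) (h01 : ∀ v, x v ∈ Icc (0 : ℝ) 1) {p a b : ℝ}
    (ha : 0 ≤ a) (hb : b ≤ 1)
    (hC : ordConnectedComponent (ironedQuantiles μ x) p = Ioo a b) :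
    μ (componentValues μ x p) = ENNReal.ofReal (b - a) := by
  have h : μ (componentValues μ x p) = unif.map (quantile μ) (componentValues μ x p) := by
    rw [map_quantile μ]
  rw [h, Measure.map_apply_of_aemeasurable (aemeasurable_quantile μ)
    (measurableSet_componentValues p), measure_congr (quantile_preimage_componentValues hx h01 p),
    hC, Measure.restrict_apply measurableSet_Ioo,
    inter_eq_self_of_subset_left (Ioo_subset_Ioo ha hb), Real.volume_Ioo]

theorem setIntegral_componentValues (hx : Measurable x) (h01 : ∀ v, x v ∈ Icc (0 : ℝ) 1)
    {p a b : ℝ} (ha : 0 ≤ a) (hab : a ≤ b) (hb : b ≤ 1)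
    (hC : ordConnectedComponent (ironedQuantiles μ x) p = Ioo a b) :
    ∫ w in componentValues μ x p, x w ∂μ = cumAlloc μ x b - cumAlloc μ x a := by
  have h : ∫ w in componentValues μ x p, x w ∂μ =
      ∫ w in componentValues μ x p, x w ∂(unif.map (quantile μ)) := by
    rw [map_quantile μ]
  rw [h, setIntegral_map (measurableSet_componentValues p) hx.aestronglyMeasurable
    (aemeasurable_quantile μ), setIntegral_congr_set (quantile_preimage_componentValues hx h01 p),
    hC, Measure.restrict_restrict measurableSet_Ioo,
    inter_eq_self_of_subset_left (Ioo_subset_Ioo ha hb),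
    cumAlloc_sub hx h01 ⟨ha, hab.trans hb⟩ ⟨ha.trans hab, hb⟩,
    intervalIntegral.integral_of_le hab, integral_Ioc_eq_integral_Ioo]

theorem measure_componentValues_ne_zero (hx : Measurable x) (h01 : ∀ v, x v ∈ Icc (0 : ℝ) 1)
    {p : ℝ} (hp : p ∈ ironedQuantiles μ x) : μ (componentValues μ x p) ≠ 0 := by
  obtain ⟨a, b, ha, hab, hb, -, -, -, hC⟩ := exists_ordConnectedComponent_eq_Ioo
    (isOpen_ironedQuantiles hx h01) (ironedQuantiles_subset hx h01) hp
  rw [measure_componentValues hx h01 ha hb hC]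
  simpa using hab

theorem isProbabilityMeasure_redraw (hx : Measurable x) (h01 : ∀ v, x v ∈ Icc (0 : ℝ) 1) (v : ℝ) :
    IsProbabilityMeasure (redraw μ x v) := by
  by_cases hv : quantileOf μ v ∈ ironedQuantiles μ x
  · rw [redraw_of_mem hv]
    exact cond_isProbabilityMeasure (measure_componentValues_ne_zero hx h01 hv)
  · rw [redraw_of_notMem hv]
    infer_instance

/-- The unironed values together with the values whose quantile shares a component with a given
rational number; these sets cover the line. -/
def ironingCover (μ : Measure ℝ) (x : ℝ → ℝ) : Option ℚ → Set ℝ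
  | none => {v | quantileOf μ v ∉ ironedQuantiles μ x}
  | some r => componentValues μ x r

theorem iUnion_ironingCover (hx : Measurable x) (h01 : ∀ v, x v ∈ Icc (0 : ℝ) 1) :
    ⋃ i, ironingCover μ x i = univ := by
  refine eq_univ_of_forall fun v => mem_iUnion.2 ?_
  by_cases hv : quantileOf μ v ∈ ironedQuantiles μ x
  · obtain ⟨a, b, -, hab, -, -, -, hvI, hC⟩ := exists_ordConnectedComponent_eq_Ioo
      (isOpen_ironedQuantiles hx h01) (ironedQuantiles_subset hx h01) hv
    obtain ⟨r, hr1, hr2⟩ := exists_rat_btwn hab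
    refine ⟨some r, ?_⟩
    have : (r : ℝ) ∈ ordConnectedComponent (ironedQuantiles μ x) (quantileOf μ v) := by
      rw [hC]; exact ⟨hr1, hr2⟩
    exact mem_ordConnectedComponent_comm.1 this
  · exact ⟨none, hv⟩

theorem measurableSet_ironingCover (hx : Measurable x) (h01 : ∀ v, x v ∈ Icc (0 : ℝ) 1)
    (i : Option ℚ) : MeasurableSet (ironingCover μ x i) := by
  cases i with
  | none => exact (measurable_quantileOf μ (isOpen_ironedQuantiles hx h01).measurableSet).compl
  | some r => exact measurableSet_componentValues _

/-- On each piece of the countable cover `redraw` is either the Dirac kernel or constant. -/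
theorem measurable_redraw (hx : Measurable x) (h01 : ∀ v, x v ∈ Icc (0 : ℝ) 1) :
    Measurable (redraw μ x) := by
  intro S hS
  have h : redraw μ x ⁻¹' S = ⋃ i, ironingCover μ x i ∩ redraw μ x ⁻¹' S := by
    rw [← iUnion_inter, iUnion_ironingCover hx h01, univ_inter]
  rw [h]
  refine MeasurableSet.iUnion fun i => ?_
  have hi := measurableSet_ironingCover (μ := μ) hx h01 i
  cases i with
  | none =>
    have : ironingCover μ x none ∩ redraw μ x ⁻¹' S =
        ironingCover μ x none ∩ Measure.dirac ⁻¹' S := by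
      ext v
      refine and_congr_right fun hv => ?_
      rw [mem_preimage, mem_preimage, redraw_of_notMem hv]
    rw [this]
    exact hi.inter (Measure.measurable_dirac hS)
  | some r =>
    have : ironingCover μ x (some r) ∩ redraw μ x ⁻¹' S =
        ironingCover μ x (some r) ∩ (fun _ => μ[|componentValues μ x r]) ⁻¹' S := by
      ext v
      refine and_congr_right fun hv => ?_
      rw [mem_preimage, mem_preimage, redraw_of_mem_componentValues hv]
    rw [this]
    exact hi.inter (measurable_const hS)

/-- Redrawing keeps a value inside its piece of the cover. -/
theorem redraw_inter_ironingCover (i : Option ℚ) (v : ℝ) {B : Set ℝ} (hB : MeasurableSet B)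
    (hi : MeasurableSet (ironingCover μ x i)) :
    redraw μ x v (B ∩ ironingCover μ x i) =
      (ironingCover μ x i).indicator (fun v => redraw μ x v (B ∩ ironingCover μ x i)) v := by
  by_cases hvi : v ∈ ironingCover μ x i
  · rw [indicator_of_mem hvi]
  rw [indicator_of_notMem hvi]
  by_cases hv : quantileOf μ v ∈ ironedQuantiles μ x
  · rw [redraw_of_mem hv, cond_apply (measurableSet_componentValues _)]
    have : componentValues μ x (quantileOf μ v) ∩ (B ∩ ironingCover μ x i) = ∅ := by
      rw [eq_empty_iff_forall_notMem]
      rintro w ⟨hw, -, hwi⟩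
      cases i with
      | none => exact hwi (ordConnectedComponent_subset hw)
      | some r =>
        exact hvi (mem_ordConnectedComponent_trans hwi (mem_ordConnectedComponent_comm.1 hw))
    simp [this]
  · rw [redraw_of_notMem hv, Measure.dirac_apply' _ (hB.inter hi),
      indicator_of_notMem fun h => hvi h.2]

/-- Redrawing preserves the distribution. -/
theorem bind_redraw (hx : Measurable x) (h01 : ∀ v, x v ∈ Icc (0 : ℝ) 1) :
    μ.bind (redraw μ x) = μ := by
  refine Measure.ext_of_iUnion_eq_univ (iUnion_ironingCover (μ := μ) hx h01) fun i => ?_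
  have hi := measurableSet_ironingCover (μ := μ) hx h01 i
  ext B hB
  rw [Measure.restrict_apply hB, Measure.restrict_apply hB,
    Measure.bind_apply (hB.inter hi) (measurable_redraw hx h01).aemeasurable,
    lintegral_congr fun v => redraw_inter_ironingCover i v hB hi, lintegral_indicator hi]
  cases i with
  | none =>
    rw [setLIntegral_congr_fun hi (g := fun v => B.indicator 1 v)]
    · rw [lintegral_indicator_one hB, Measure.restrict_apply hB]
    · intro v hv
      simp only [redraw_of_notMem hv, Measure.dirac_apply' _ (hB.inter hi)]
      by_cases hvB : v ∈ B
      · rw [indicator_of_mem hvB, indicator_of_mem (show v ∈ B ∩ ironingCover μ x none from ⟨hvB, hv⟩)]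
      · rw [indicator_of_notMem hvB, indicator_of_notMem fun h => hvB h.1]
  | some r =>
    rw [setLIntegral_congr_fun hi
      (g := fun _ => μ[|componentValues μ x r] (B ∩ componentValues μ x r))]
    · rw [setLIntegral_const, cond_apply (measurableSet_componentValues _)]
      change _ * μ (componentValues μ x r) = μ (B ∩ componentValues μ x r)
      rw [inter_comm B, ← inter_assoc, inter_self]
      -- A rational outside `ironedQuantiles` has an empty piece, so the null case does occur.
      rcases eq_or_ne (μ (componentValues μ x r)) 0 with h0 | h0
      · rw [h0, mul_zero]
        exact (measure_mono_null inter_subset_left h0).symm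
      · rw [mul_right_comm, ENNReal.inv_mul_cancel h0 (measure_ne_top _ _), one_mul]
    · intro v hv
      simp only [redraw_of_mem_componentValues hv]
      rfl

/-- The mean of x under the conditioned law is the increment of G over the component divided by its
mass b - a, which is the slope of the chord. -/
theorem ironedAlloc_of_component (hx : Measurable x) (h01 : ∀ v, x v ∈ Icc (0 : ℝ) 1) {v p a b : ℝ}
    (ha : 0 ≤ a) (hab : a < b) (hb : b ≤ 1)
    (hC : ordConnectedComponent (ironedQuantiles μ x) p = Ioo a b)
    (hv : v ∈ componentValues μ x p) :
    ironedAlloc μ x v = (cumAlloc μ x b - cumAlloc μ x a) / (b - a) := by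
  rw [ironedAlloc, redraw_of_mem_componentValues hv, ProbabilityTheory.cond, integral_smul_measure,
    setIntegral_componentValues hx h01 ha hab.le hb hC, measure_componentValues hx h01 ha hb hC,
    ENNReal.toReal_inv, ENNReal.toReal_ofReal (sub_nonneg.2 hab.le), smul_eq_mul, div_eq_inv_mul]

theorem ironedAlloc_mem_Icc (hx : Measurable x) (h01 : ∀ v, x v ∈ Icc (0 : ℝ) 1) (v : ℝ) :
    ironedAlloc μ x v ∈ Icc (0 : ℝ) 1 := by
  have := isProbabilityMeasure_redraw (μ := μ) hx h01 v
  refine ⟨integral_nonneg fun w => (h01 w).1, ?_⟩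
  calc ironedAlloc μ x v ≤ ∫ _, (1 : ℝ) ∂(redraw μ x v) :=
        integral_mono_of_nonneg (Filter.Eventually.of_forall fun w => (h01 w).1)
          (integrable_const _) (Filter.Eventually.of_forall fun w => (h01 w).2)
    _ = 1 := by simp

theorem ofReal_ironedAlloc (hx : Measurable x) (h01 : ∀ v, x v ∈ Icc (0 : ℝ) 1) (v : ℝ) :
    ENNReal.ofReal (ironedAlloc μ x v) = ∫⁻ w, ENNReal.ofReal (x w) ∂(redraw μ x v) := by
  have := isProbabilityMeasure_redraw (μ := μ) hx h01 v
  exact ofReal_integral_eq_lintegral_ofReal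
    (Integrable.of_mem_Icc 0 1 hx.aemeasurable (Filter.Eventually.of_forall h01))
    (Filter.Eventually.of_forall fun w => (h01 w).1)

theorem measurable_ironedAlloc (hx : Measurable x) (h01 : ∀ v, x v ∈ Icc (0 : ℝ) 1) :
    Measurable (ironedAlloc μ x) := by
  have h : ironedAlloc μ x =
      fun v => (∫⁻ w, ENNReal.ofReal (x w) ∂(redraw μ x v)).toReal := by
    ext v
    rw [← ofReal_ironedAlloc hx h01, ENNReal.toReal_ofReal (ironedAlloc_mem_Icc hx h01 v).1]
  rw [h]
  exact ((Measure.measurable_lintegral hx.ennreal_ofReal).comp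
    (measurable_redraw hx h01)).ennreal_toReal

/-! ### Monotonicity and welfare gain of the ironed allocation -/

/-- On an ironed component both sides are the slope of the chord. Elsewhere the hull touches G,
whose derivative is almost everywhere the unironed allocation. -/
theorem ae_hasDerivAt_hull (hx : Measurable x) (h01 : ∀ v, x v ∈ Icc (0 : ℝ) 1) :
    ∀ᵐ q ∂unif, HasDerivAt (hull μ x) (ironedAlloc μ x (quantile μ q)) q := by
  filter_upwards [ae_isRepresented μ, ae_hasDerivAt_cumAlloc (μ := μ) hx h01,
    ae_restrict_mem measurableSet_Ioo] with q hq hG hq1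
  by_cases hU : q ∈ ironedQuantiles μ x
  · obtain ⟨a, b, ha, hab, hb, haU, hbU, hqI, hC⟩ := exists_ordConnectedComponent_eq_Ioo
      (isOpen_ironedQuantiles hx h01) (ironedQuantiles_subset hx h01) hU
    rw [ironedAlloc_of_component hx h01 ha hab hb hC
      ((hq.mem_component_iff hx h01 q).2 (self_mem_ordConnectedComponent.2 hU))]
    exact hasDerivAt_hull_of_component hx h01 ha hb haU hbU
      (hC ▸ ordConnectedComponent_subset) hqI
  · rw [ironedAlloc_of_notMem fun h => hU ((hq.mem_iff hx h01).1 h)]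
    exact hasDerivAt_of_convexOn_of_touch (convexOn_hull hx h01) (fun _ => hull_le hx h01) hq1
      (hull_eq_of_notMem hx h01 (Ioo_subset_Icc_self hq1) hU) hG

/-- The ironed allocation is almost everywhere equal to a monotone function. -/
theorem exists_monotone_ae_eq_ironedAlloc (hx : Measurable x) (h01 : ∀ v, x v ∈ Icc (0 : ℝ) 1) :
    ∃ h : ℝ → ℝ, Monotone h ∧ (∀ z, h z ∈ Icc (0 : ℝ) 1) ∧ ∀ᵐ v ∂μ, ironedAlloc μ x v = h v := by
  set E := {q | q ∈ Ioo (0 : ℝ) 1 ∧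
    HasDerivAt (hull μ x) (ironedAlloc μ x (quantile μ q)) q} with hE
  have hmono : MonotoneOn (ironedAlloc μ x) (quantile μ '' E) := by
    rintro _ ⟨q, hq, rfl⟩ _ ⟨q', hq', rfl⟩ hle
    -- Different quantiles may share a value; if the order of quantiles disagrees with that of
    -- values, the two values coincide.
    rcases le_or_gt q' q with h | h
    · rw [le_antisymm hle (monotoneOn_quantile μ hq'.1 hq.1 h)]
    · exact ((convexOn_hull hx h01).le_slope_of_hasDerivAt (Ioo_subset_Icc_self hq.1)
        (Ioo_subset_Icc_self hq'.1) h hq.2).trans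
        ((convexOn_hull hx h01).slope_le_of_hasDerivAt (Ioo_subset_Icc_self hq.1)
        (Ioo_subset_Icc_self hq'.1) h hq'.2)
  obtain ⟨g, hg, hgeq⟩ := hmono.exists_monotone_extension
    ⟨0, by rintro _ ⟨v, -, rfl⟩; exact (ironedAlloc_mem_Icc hx h01 v).1⟩
    ⟨1, by rintro _ ⟨v, -, rfl⟩; exact (ironedAlloc_mem_Icc hx h01 v).2⟩
  have hmg : Monotone fun v => max 0 (min 1 (g v)) := fun a b hab =>
    max_le_max le_rfl (min_le_min le_rfl (hg hab))
  refine ⟨fun v => max 0 (min 1 (g v)), hmg,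
    fun v => ⟨le_max_left _ _, max_le zero_le_one (min_le_left _ _)⟩, ?_⟩
  have hms : MeasurableSet {v | ironedAlloc μ x v = max 0 (min 1 (g v))} :=
    measurableSet_eq_fun (measurable_ironedAlloc hx h01) hmg.measurable
  have hae : ∀ᵐ v ∂(unif.map (quantile μ)), ironedAlloc μ x v = max 0 (min 1 (g v)) := by
    rw [ae_map_iff (aemeasurable_quantile μ) hms]
    filter_upwards [ae_hasDerivAt_hull (μ := μ) hx h01, ae_restrict_mem measurableSet_Ioo]
      with q hq hq1
    rw [← hgeq ⟨q, ⟨hq1, hq⟩, rfl⟩]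
    have := ironedAlloc_mem_Icc (μ := μ) hx h01 (quantile μ q)
    rw [min_eq_right this.2, max_eq_right this.1]
  rwa [map_quantile μ] at hae

/-- The left side is the increment of the hull from 0 to t, the right side is G(t), and the hull is
nonnegative at 0 and at most G at t. The right derivative serves for the fundamental theorem because
a convex function has one at every interior point. -/
theorem intervalIntegral_ironedAlloc_le (hx : Measurable x) (h01 : ∀ v, x v ∈ Icc (0 : ℝ) 1)
    {t : ℝ} (ht : t ∈ Icc (0 : ℝ) 1) :
    ∫ q in (0 : ℝ)..t, ironedAlloc μ x (quantile μ q) ≤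
      ∫ q in (0 : ℝ)..t, x (quantile μ q) := by
  have hH := convexOn_hull (μ := μ) hx h01
  have hae : ∀ᵐ q, q ∈ Ioc (0 : ℝ) t →
      ironedAlloc μ x (quantile μ q) = derivWithin (hull μ x) (Ioi q) q := by
    have h1 : ∀ᵐ q : ℝ, q ≠ 1 := by simp [ae_iff]
    filter_upwards [(ae_restrict_iff' measurableSet_Ioo).1 (ae_hasDerivAt_hull (μ := μ) hx h01), h1]
      with q hq hq1 hqt
    exact ((hq ⟨hqt.1, lt_of_le_of_ne (hqt.2.trans ht.2) hq1⟩).hasDerivWithinAt.derivWithin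
      (uniqueDiffWithinAt_Ioi q)).symm
  have hint := intervalIntegrable_comp_quantile (μ := μ) (measurable_ironedAlloc (μ := μ) hx h01)
    (ironedAlloc_mem_Icc hx h01) (a := 0) (b := t) (by simp) ht
  have hcongr := intervalIntegral.integral_congr_ae' (μ := volume) (a := 0) (b := t) hae
    (by filter_upwards with q hq; exact absurd (hq.1.trans_le hq.2) (not_lt.2 ht.1))
  rw [hcongr, intervalIntegral.integral_eq_sub_of_hasDeriv_right_of_le ht.1
    ((continuousOn_hull (μ := μ) hx h01).mono (Icc_subset_Icc_right ht.2))]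
  · have h1 := hull_le (μ := μ) hx h01 ht
    have h2 := hull_nonneg (μ := μ) hx h01 (q := 0) (by simp)
    have h3 : cumAlloc μ x t = ∫ q in (0 : ℝ)..t, x (quantile μ q) := rfl
    linarith
  · intro q hq
    exact hH.hasDerivWithinAt_rightDeriv_of_mem_interior (by
      rw [interior_Icc]; exact ⟨hq.1, hq.2.trans_le ht.2⟩)
  · rw [intervalIntegrable_iff, uIoc_of_le ht.1] at hint ⊢
    exact hint.congr ((ae_restrict_iff' measurableSet_Ioc).2 hae)

theorem setIntegral_Iic_eq (hx : Measurable x) (t : ℝ) :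
    ∫ v in Iic t, x v ∂μ = ∫ q in (0 : ℝ)..μ.real (Iic t), x (quantile μ q) := by
  have h : ∫ w in Iic t, x w ∂μ = ∫ w in Iic t, x w ∂(unif.map (quantile μ)) := by
    rw [map_quantile μ]
  have hset : quantile μ ⁻¹' Iic t =ᵐ[unif] Iic (μ.real (Iic t)) := by
    filter_upwards [ae_restrict_mem measurableSet_Ioo] with q hq
    exact propext (quantile_le_iff μ hq t)
  rw [h, setIntegral_map measurableSet_Iic hx.aestronglyMeasurable (aemeasurable_quantile μ),
    setIntegral_congr_set hset, intervalIntegral.integral_of_le measureReal_nonneg, unif,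
    Measure.restrict_congr_set (Ioo_ae_eq_Ioc (a := (0 : ℝ)) (b := 1) (μ := volume)),
    Measure.restrict_restrict measurableSet_Iic]
  congr 2
  ext q
  have := measureReal_le_one (μ := μ) (s := Iic t)
  simp only [mem_inter_iff, mem_Iic, mem_Ioc]
  exact ⟨fun h => ⟨h.2.1, h.1⟩, fun h => ⟨h.2, h.1, h.2.trans this⟩⟩

theorem integral_ironedAlloc (hx : Measurable x) (h01 : ∀ v, x v ∈ Icc (0 : ℝ) 1) :
    ∫ v, ironedAlloc μ x v ∂μ = ∫ v, x v ∂μ := by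
  rw [integral_eq_lintegral_of_nonneg_ae
    (Filter.Eventually.of_forall fun v => (ironedAlloc_mem_Icc hx h01 v).1)
    (measurable_ironedAlloc hx h01).aestronglyMeasurable,
    integral_eq_lintegral_of_nonneg_ae (Filter.Eventually.of_forall fun v => (h01 v).1)
    hx.aestronglyMeasurable]
  simp_rw [ofReal_ironedAlloc hx h01]
  rw [← Measure.lintegral_bind (measurable_redraw hx h01).aemeasurable
    hx.ennreal_ofReal.aemeasurable, bind_redraw hx h01]

/-- Ironing moves allocation probability from low values to high values. -/
theorem setIntegral_Ioi_le_ironedAlloc (hx : Measurable x) (h01 : ∀ v, x v ∈ Icc (0 : ℝ) 1)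
    (t : ℝ) : ∫ v in Ioi t, x v ∂μ ≤ ∫ v in Ioi t, ironedAlloc μ x v ∂μ := by
  have hx' := measurable_ironedAlloc (μ := μ) hx h01
  have h01' := ironedAlloc_mem_Icc (μ := μ) hx h01
  have h1 := integral_add_compl (μ := μ) (measurableSet_Iic (a := t))
    (Integrable.of_mem_Icc 0 1 hx.aemeasurable (Filter.Eventually.of_forall h01))
  have h2 := integral_add_compl (μ := μ) (measurableSet_Iic (a := t))
    (Integrable.of_mem_Icc 0 1 hx'.aemeasurable (Filter.Eventually.of_forall h01'))
  have h3 := intervalIntegral_ironedAlloc_le (μ := μ) hx h01 (t := μ.real (Iic t))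
    ⟨measureReal_nonneg, measureReal_le_one⟩
  rw [← setIntegral_Iic_eq hx, ← setIntegral_Iic_eq hx'] at h3
  rw [compl_Iic] at h1 h2
  rw [integral_ironedAlloc hx h01] at h2
  linarith

/-- Ironing increases the expected welfare. -/
theorem integral_mul_le_integral_mul_ironedAlloc (hx : Measurable x)
    (h01 : ∀ v, x v ∈ Icc (0 : ℝ) 1) (hμ0 : μ (Iio 0) = 0)
    (hμ : Integrable (fun t : ℝ => t) μ) :
    ∫ v, v * x v ∂μ ≤ ∫ v, v * ironedAlloc μ x v ∂μ := by
  have hx' := measurable_ironedAlloc (μ := μ) hx h01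
  have h01' := ironedAlloc_mem_Icc (μ := μ) hx h01
  have hnn : ∀ᵐ v ∂μ, 0 ≤ v := by
    rw [ae_iff]; simpa [Iio_def] using hμ0
  -- Layer-cake formula for the measure of density y with respect to μ: it reduces the weighted
  -- integral to the tails {v > t}.
  have key : ∀ y : ℝ → ℝ, Measurable y → (∀ v, y v ∈ Icc (0 : ℝ) 1) →
      ∫⁻ v, ENNReal.ofReal (v * y v) ∂μ =
        ∫⁻ t in Ioi (0 : ℝ), ENNReal.ofReal (∫ v in Ioi t, y v ∂μ) := by
    intro y hy hy01
    have h1 : ∫⁻ v, ENNReal.ofReal (v * y v) ∂μ =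
        ∫⁻ v, ENNReal.ofReal v ∂(μ.withDensity fun v => ENNReal.ofReal (y v)) := by
      rw [lintegral_withDensity_eq_lintegral_mul _ hy.ennreal_ofReal ENNReal.measurable_ofReal]
      refine lintegral_congr fun v => ?_
      rw [mul_comm, ENNReal.ofReal_mul (hy01 v).1]
      rfl
    rw [h1, lintegral_eq_lintegral_meas_lt _
      ((withDensity_absolutelyContinuous _ _).ae_le hnn) measurable_id.aemeasurable]
    refine lintegral_congr fun t => ?_
    change (μ.withDensity fun v => ENNReal.ofReal (y v)) (Ioi t) = _
    rw [withDensity_apply _ measurableSet_Ioi, ofReal_integral_eq_lintegral_ofReal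
      (Integrable.of_mem_Icc 0 1 hy.aemeasurable (Filter.Eventually.of_forall hy01))
      (Filter.Eventually.of_forall fun v => (hy01 v).1)]
  have hle : ∫⁻ v, ENNReal.ofReal (v * x v) ∂μ ≤
      ∫⁻ v, ENNReal.ofReal (v * ironedAlloc μ x v) ∂μ := by
    rw [key x hx h01, key _ hx' h01']
    exact lintegral_mono fun t =>
      ENNReal.ofReal_le_ofReal (setIntegral_Ioi_le_ironedAlloc hx h01 t)
  have hintb : Integrable (fun v => v * ironedAlloc μ x v) μ :=
    hμ.mul_bdd (c := 1) hx'.aestronglyMeasurable (Filter.Eventually.of_forall fun v => by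
      rw [Real.norm_of_nonneg (h01' v).1]; exact (h01' v).2)
  rw [integral_eq_lintegral_of_nonneg_ae
      (by filter_upwards [hnn] with v hv using mul_nonneg hv (h01 v).1)
      (by fun_prop),
    integral_eq_lintegral_of_nonneg_ae
      (by filter_upwards [hnn] with v hv using mul_nonneg hv (h01' v).1)
      (by fun_prop)]
  exact ENNReal.toReal_mono hintb.lintegral_lt_top.ne hle

end Redraw

section Product

/-! ### Product distributions -/

variable {n : ℕ}

theorem measurable_pi_kernel {κ : Fin n → ℝ → Measure ℝ} (hκ : ∀ i, Measurable (κ i))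
    [∀ i v, IsProbabilityMeasure (κ i v)] :
    Measurable fun v : Profile n => Measure.pi fun i => κ i (v i) := by
  refine Measurable.measure_of_isPiSystem_of_isProbabilityMeasure generateFrom_pi.symm
    isPiSystem_pi ?_
  rintro _ ⟨s, hs, rfl⟩
  simp_rw [Measure.pi_pi]
  exact Finset.measurable_prod _ fun i _ =>
    (Measure.measurable_coe (show MeasurableSet (s i) from hs i (mem_univ i))).comp ((hκ i).comp (measurable_pi_apply i))

/-- On a box the kernel is a product of functions of separate, independent coordinates, so the
integral factorizes. -/
theorem bind_pi (F : Fin n → Measure ℝ) [∀ i, IsProbabilityMeasure (F i)]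
    {κ : Fin n → ℝ → Measure ℝ} (hκ : ∀ i, Measurable (κ i))
    [∀ i v, IsProbabilityMeasure (κ i v)] :
    (Measure.pi F).bind (fun v => Measure.pi fun i => κ i (v i)) =
      Measure.pi fun i => (F i).bind (κ i) := by
  have hprob : ∀ i, IsProbabilityMeasure ((F i).bind (κ i)) := fun i =>
    isProbabilityMeasure_bind (hκ i).aemeasurable
      (Filter.Eventually.of_forall fun v => inferInstance)
  refine (Measure.pi_eq fun s hs => ?_).symm
  rw [Measure.bind_apply (MeasurableSet.univ_pi hs) (measurable_pi_kernel hκ).aemeasurable]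
  simp_rw [Measure.pi_pi]
  have hmeas : ∀ i, Measurable fun t => κ i t (s i) := fun i =>
    (Measure.measurable_coe (hs i)).comp (hκ i)
  rw [lintegral_prod_eq_prod_lintegral_of_indepFun Finset.univ
    (fun i (v : Profile n) => κ i (v i) (s i))
    (iIndepFun_pi (X := fun i t => κ i t (s i)) fun i => (hmeas i).aemeasurable)
    fun i => (hmeas i).comp (measurable_pi_apply i)]
  refine Finset.prod_congr rfl fun i _ => ?_
  rw [Measure.bind_apply (hs i) (hκ i).aemeasurable]
  exact (measurePreserving_eval F i).lintegral_comp (hmeas i)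

theorem measurable_update_prod (i : Fin n) :
    Measurable fun p : Profile n × ℝ => Function.update p.1 i p.2 := measurable_update'

/-- An interim quantity integrates over a whole profile and then overwrites coordinate i. This
identity turns it, once the bid is averaged over ρ, into an integral over a product law with factor
i replaced. -/
theorem map_update_prod (F : Fin n → Measure ℝ) [∀ i, IsProbabilityMeasure (F i)] (i : Fin n)
    (ρ : Measure ℝ) [IsProbabilityMeasure ρ] :
    ((Measure.pi F).prod ρ).map (fun p => Function.update p.1 i p.2) =
      Measure.pi (Function.update F i ρ) := by
  have hprob : ∀ j, IsProbabilityMeasure (Function.update F i ρ j) := by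
    intro j
    rcases eq_or_ne j i with rfl | h
    · simpa
    · simpa [h] using (inferInstance : IsProbabilityMeasure (F j))
  refine (Measure.pi_eq fun s hs => ?_).symm
  rw [Measure.map_apply (measurable_update_prod i) (MeasurableSet.univ_pi hs)]
  have hpre : (fun p : Profile n × ℝ => Function.update p.1 i p.2) ⁻¹' univ.pi s =
      (univ.pi (Function.update s i univ)) ×ˢ (s i) := by
    ext ⟨v, t⟩
    simp only [mem_preimage, mem_univ_pi, mem_prod]
    constructor
    · intro h
      refine ⟨fun j => ?_, by simpa using h i⟩
      rcases eq_or_ne j i with rfl | hj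
      · simp
      · simpa [hj] using h j
    · rintro ⟨h, ht⟩ j
      rcases eq_or_ne j i with rfl | hj
      · simpa using ht
      · simpa [hj] using h j
  rw [hpre, Measure.prod_prod, Measure.pi_pi,
    ← Finset.mul_prod_erase _ _ (Finset.mem_univ i), ← Finset.mul_prod_erase Finset.univ
      (fun j => Function.update F i ρ j (s j)) (Finset.mem_univ i)]
  simp only [Function.update_self, measure_univ, one_mul]
  rw [mul_comm]
  congr 1
  refine Finset.prod_congr rfl fun j hj => ?_
  rw [Function.update_of_ne (Finset.ne_of_mem_erase hj),
    Function.update_of_ne (Finset.ne_of_mem_erase hj)]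

/-! ### Interim allocations -/

variable (F : Fin n → Measure ℝ) [∀ i, IsProbabilityMeasure (F i)]

theorem measurable_kernel_apply (A : Algorithm n) (S : Set (Alloc n)) :
    Measurable fun v => A v S := A.measurable_coe (Set.toFinite S).measurableSet

theorem ofReal_interimAlloc (A : Algorithm n) [IsMarkovKernel A] (i : Fin n) (b : ℝ) :
    ENNReal.ofReal (interimAlloc F A i b) =
      ∫⁻ v, A (Function.update v i b) {x | x i = true} ∂(Measure.pi F) := by
  have hm : Measurable fun v : Profile n => A (Function.update v i b) {x | x i = true} :=
    (measurable_kernel_apply A _).comp (measurable_update_prod i |>.comp measurable_prodMk_right)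
  rw [interimAlloc, ofReal_integral_eq_lintegral_ofReal]
  · exact lintegral_congr fun v => ofReal_measureReal
  · exact Integrable.of_mem_Icc 0 1 hm.ennreal_toReal.aemeasurable
      (Filter.Eventually.of_forall fun v => ⟨measureReal_nonneg, measureReal_le_one⟩)
  · exact Filter.Eventually.of_forall fun v => measureReal_nonneg

theorem interimAlloc_mem_Icc (A : Algorithm n) [IsMarkovKernel A] (i : Fin n) (b : ℝ) :
    interimAlloc F A i b ∈ Icc (0 : ℝ) 1 := by
  refine ⟨integral_nonneg fun _ => measureReal_nonneg, ?_⟩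
  calc interimAlloc F A i b ≤ ∫ _, (1 : ℝ) ∂(Measure.pi F) :=
        integral_mono_of_nonneg (Filter.Eventually.of_forall fun _ => measureReal_nonneg)
          (integrable_const _) (Filter.Eventually.of_forall fun _ => measureReal_le_one)
    _ = 1 := by simp

theorem measurable_interimAlloc (A : Algorithm n) [IsMarkovKernel A] (i : Fin n) :
    Measurable (interimAlloc F A i) := by
  have h : interimAlloc F A i = fun b =>
      (∫⁻ v, A (Function.update v i b) {x | x i = true} ∂(Measure.pi F)).toReal := by
    ext b
    rw [← ofReal_interimAlloc, ENNReal.toReal_ofReal (interimAlloc_mem_Icc F A i b).1]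
  rw [h]
  exact (Measurable.lintegral_prod_left' ((measurable_kernel_apply A _).comp
    (measurable_update_prod i))).ennreal_toReal

theorem lintegral_interimAlloc (A : Algorithm n) [IsMarkovKernel A] (i : Fin n) (ρ : Measure ℝ)
    [IsProbabilityMeasure ρ] :
    ∫⁻ t, ENNReal.ofReal (interimAlloc F A i t) ∂ρ =
      ∫⁻ w, A w {x | x i = true} ∂(Measure.pi (Function.update F i ρ)) := by
  have hm : Measurable fun p : Profile n × ℝ =>
      A (Function.update p.1 i p.2) {x | x i = true} :=
    (measurable_kernel_apply A _).comp (measurable_update_prod i)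
  rw [← map_update_prod, lintegral_map (measurable_kernel_apply A _) (measurable_update_prod i),
    lintegral_prod_symm' _ hm]
  simp_rw [ofReal_interimAlloc]

/-- The interim allocation when each bid is perturbed independently, preserving all bid
distributions. -/
theorem ofReal_interimAlloc_of_bind (A B : Algorithm n) [IsMarkovKernel A] [IsMarkovKernel B]
    {κ : Fin n → ℝ → Measure ℝ} (hκ : ∀ i, Measurable (κ i))
    [∀ i v, IsProbabilityMeasure (κ i v)] (hinv : ∀ i, (F i).bind (κ i) = F i)
    (hB : ∀ v, B v = (Measure.pi fun i => κ i (v i)).bind A) (i : Fin n) (b : ℝ) :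
    ENNReal.ofReal (interimAlloc F B i b) =
      ∫⁻ t, ENNReal.ofReal (interimAlloc F A i t) ∂(κ i b) := by
  rw [lintegral_interimAlloc, ofReal_interimAlloc]
  -- With the bid of agent i fixed at b, that coordinate is perturbed by the constant kernel `κ i
  -- b`, whatever the overwritten value was.
  set κ' : Fin n → ℝ → Measure ℝ := Function.update κ i fun _ => κ i b with hκ'
  have hκ'm : ∀ j, Measurable (κ' j) := by
    intro j
    rcases eq_or_ne j i with rfl | h
    · simp [hκ']
    · simpa [hκ', h] using hκ j
  have hκ'p : ∀ j v, IsProbabilityMeasure (κ' j v) := by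
    intro j v
    rcases eq_or_ne j i with rfl | h
    · simpa [hκ'] using (inferInstance : IsProbabilityMeasure (κ j b))
    · simpa [hκ', h] using (inferInstance : IsProbabilityMeasure (κ j v))
  have h1 : ∀ v : Profile n, (Measure.pi fun j => κ j (Function.update v i b j)) =
      Measure.pi fun j => κ' j (v j) := by
    intro v
    congr 1
    ext1 j
    rcases eq_or_ne j i with rfl | h
    · simp [hκ']
    · simp [hκ', h]
  -- By invariance the opponents regain their own laws, and only coordinate i carries the law `κ i
  -- b`.
  have h2 : (fun j => (F j).bind (κ' j)) = Function.update F i (κ i b) := by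
    ext1 j
    rcases eq_or_ne j i with rfl | h
    · simp [hκ', Measure.bind_const]
    · simp [hκ', h, hinv]
  simp_rw [hB, h1, Measure.bind_apply (Set.toFinite {x : Alloc n | x i = true}).measurableSet
    A.measurable.aemeasurable]
  rw [← h2, ← bind_pi F hκ'm, Measure.lintegral_bind (measurable_pi_kernel hκ'm).aemeasurable
    (measurable_kernel_apply A _).aemeasurable]

theorem integrable_eval (hF : ∀ i, Integrable (fun t : ℝ => t) (F i)) (i : Fin n) :
    Integrable (fun v : Profile n => v i) (Measure.pi F) :=
  (measurePreserving_eval F i).integrable_comp_of_integrable (hF i)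

theorem integrable_eval_mul (hF : ∀ i, Integrable (fun t : ℝ => t) (F i)) (A : Algorithm n)
    [IsMarkovKernel A] (i : Fin n) (S : Set (Alloc n)) :
    Integrable (fun v : Profile n => v i * (A v).real S) (Measure.pi F) :=
  (integrable_eval F hF i).mul_bdd (c := 1)
    (measurable_kernel_apply A S).ennreal_toReal.aestronglyMeasurable
    (Filter.Eventually.of_forall fun v => by
      rw [Real.norm_of_nonneg measureReal_nonneg]; exact measureReal_le_one)

/-- By Fubini, agent i's share of the expected value depends on the algorithm only through the
interim allocation. -/
theorem integral_eval_mul (hF : ∀ i, Integrable (fun t : ℝ => t) (F i)) (A : Algorithm n)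
    [IsMarkovKernel A] (i : Fin n) :
    ∫ v, v i * (A v).real {x | x i = true} ∂(Measure.pi F) =
      ∫ t, t * interimAlloc F A i t ∂(F i) := by
  have hint := integrable_eval_mul F hF A i {x | x i = true}
  have hmap := map_update_prod F i (F i)
  rw [Function.update_eq_self] at hmap
  rw [← hmap] at hint ⊢
  have hint' : Integrable (fun p : Profile n × ℝ => Function.update p.1 i p.2 i *
      (A (Function.update p.1 i p.2)).real {x | x i = true}) ((Measure.pi F).prod (F i)) :=
    hint.comp_measurable (measurable_update_prod i)
  rw [integral_map (measurable_update_prod i).aemeasurable hint.aestronglyMeasurable,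
    integral_prod_symm _ hint']
  simp only [Function.update_self, integral_const_mul]
  rfl

end Product

section Welfare

/-! ### Expectations of extended-real functions -/

section Expectation

variable {Ω : Type*} [MeasurableSpace Ω] {μ : Measure Ω}

theorem expectation_mono {f g : Ω → EReal} (h : ∀ᵐ ω ∂μ, f ω ≤ g ω) :
    expectation μ f ≤ expectation μ g := by
  refine EReal.sub_le_sub ?_ ?_
  · refine EReal.coe_ennreal_le_coe_ennreal_iff.2 (lintegral_mono_ae ?_)
    filter_upwards [h] with ω hω using EReal.toENNReal_le_toENNReal hω
  · refine EReal.coe_ennreal_le_coe_ennreal_iff.2 (lintegral_mono_ae ?_)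
    filter_upwards [h] with ω hω using EReal.toENNReal_le_toENNReal (EReal.neg_le_neg_iff.2 hω)

theorem expectation_div {β : ℝ} (hβ : 0 < β) (f : Ω → EReal) :
    expectation μ (fun ω => f ω / (β : EReal)) = expectation μ f / (β : EReal) := by
  have hβ' : (0 : EReal) ≤ ((β⁻¹ : ℝ) : EReal) := EReal.coe_nonneg.2 (inv_nonneg.2 hβ.le)
  have hdiv : ∀ a : EReal, a / (β : EReal) = ((β⁻¹ : ℝ) : EReal) * a := fun a => by
    rw [EReal.div_eq_inv_mul, EReal.coe_inv]
  simp only [expectation, hdiv]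
  have hneg : ∀ a : EReal, -(((β⁻¹ : ℝ) : EReal) * a) = ((β⁻¹ : ℝ) : EReal) * -a := fun a => by
    rw [mul_comm, ← EReal.neg_mul, mul_comm]
  simp only [hneg, EReal.toENNReal_mul hβ']
  rw [lintegral_const_mul' _ _ (by simp), lintegral_const_mul' _ _ (by simp),
    EReal.coe_ennreal_mul, EReal.coe_ennreal_mul, EReal.coe_toENNReal hβ',
    EReal.mul_sub_of_nonneg_of_ne_top hβ' (EReal.coe_ne_top _)]

theorem expectation_coe {f : Ω → ℝ} (hf : Integrable f μ) :
    expectation μ (fun ω => (f ω : EReal)) = ((∫ ω, f ω ∂μ : ℝ) : EReal) := by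
  have hneg : ∫⁻ ω, ENNReal.ofReal (-f ω) ∂μ ≠ ⊤ := hf.neg.lintegral_lt_top.ne
  rw [integral_eq_lintegral_pos_part_sub_lintegral_neg_part hf, EReal.coe_sub,
    EReal.coe_ennreal_toReal hf.lintegral_lt_top.ne,
    EReal.coe_ennreal_toReal hneg]
  simp only [expectation, ← EReal.coe_neg, EReal.real_coe_toENNReal]

end Expectation

/-! ### Welfare -/

variable {n : ℕ}

/-- Expected welfare for real-valued costs. -/
noncomputable def realWelfare (c : Alloc n → ℝ) (A : Algorithm n) (v : Profile n) : ℝ :=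
  ∑ x : Alloc n, (A v).real {x} * ((∑ i, if x i = true then v i else 0) - c x)

theorem ereal_coe_sum {ι : Type*} (s : Finset ι) (f : ι → ℝ) :
    ((∑ i ∈ s, f i : ℝ) : EReal) = ∑ i ∈ s, (f i : EReal) :=
  map_sum (⟨⟨Real.toEReal, EReal.coe_zero⟩, EReal.coe_add⟩ : ℝ →+ EReal) f s

theorem algWelfare_eq_realWelfare {c : Alloc n → EReal} (hc : ∀ x, c x ≠ ⊥) {A : Algorithm n}
    {v : Profile n} (h : ∀ x, c x = ⊤ → (A v).real {x} = 0) :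
    algWelfare c A v = (realWelfare (fun x => (c x).toReal) A v : EReal) := by
  rw [algWelfare, realWelfare, ereal_coe_sum]
  refine Finset.sum_congr rfl fun x _ => ?_
  by_cases hx : c x = ⊤
  · simp [h x hx]
  · rw [EReal.coe_mul, EReal.coe_sub, EReal.coe_toReal hx (hc x), allocWelfare]

theorem realWelfare_eq (c : Alloc n → ℝ) (A : Algorithm n) [IsMarkovKernel A] (v : Profile n) :
    realWelfare c A v =
      ∑ i, v i * (A v).real {x | x i = true} - ∑ x, c x * (A v).real {x} := by
  have hserved : ∀ i : Fin n, (A v).real {x | x i = true} =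
      ∑ x : Alloc n, if x i = true then (A v).real {x} else 0 := by
    intro i
    rw [← Finset.sum_filter, sum_measureReal_singleton]
    simp
  simp only [realWelfare, mul_sub, Finset.sum_sub_distrib, Finset.mul_sum, hserved]
  rw [Finset.sum_comm]
  congr 1
  · refine Finset.sum_congr rfl fun i _ => Finset.sum_congr rfl fun x _ => ?_
    split_ifs <;> ring
  · exact Finset.sum_congr rfl fun x _ => mul_comm _ _

variable (F : Fin n → Measure ℝ) [∀ i, IsProbabilityMeasure (F i)]

theorem integrable_kernel_real (A : Algorithm n) [IsMarkovKernel A] (S : Set (Alloc n)) :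
    Integrable (fun v => (A v).real S) (Measure.pi F) :=
  Integrable.of_mem_Icc 0 1 (measurable_kernel_apply A S).ennreal_toReal.aemeasurable
    (Filter.Eventually.of_forall fun _ => ⟨measureReal_nonneg, measureReal_le_one⟩)

theorem integrable_realWelfare (hF : ∀ i, Integrable (fun t : ℝ => t) (F i)) (c : Alloc n → ℝ)
    (A : Algorithm n) [IsMarkovKernel A] : Integrable (realWelfare c A) (Measure.pi F) := by
  have h : realWelfare c A = fun v =>
      ∑ i, v i * (A v).real {x | x i = true} - ∑ x, c x * (A v).real {x} :=
    funext (realWelfare_eq c A)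
  rw [h]
  exact (integrable_finsetSum _ fun i _ => integrable_eval_mul F hF A i _).sub
    (integrable_finsetSum _ fun x _ => (integrable_kernel_real F A {x}).const_mul _)

theorem integral_realWelfare (hF : ∀ i, Integrable (fun t : ℝ => t) (F i)) (c : Alloc n → ℝ)
    (A : Algorithm n) [IsMarkovKernel A] :
    ∫ v, realWelfare c A v ∂(Measure.pi F) =
      ∑ i, ∫ t, t * interimAlloc F A i t ∂(F i) -
        ∑ x, c x * ∫ v, (A v).real {x} ∂(Measure.pi F) := by
  simp_rw [realWelfare_eq]
  rw [integral_sub (integrable_finsetSum _ fun i _ => integrable_eval_mul F hF A i _)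
    (integrable_finsetSum _ fun x _ => (integrable_kernel_real F A {x}).const_mul _),
    integral_finsetSum _ fun i _ => integrable_eval_mul F hF A i _,
    integral_finsetSum _ fun x _ => (integrable_kernel_real F A {x}).const_mul _]
  simp_rw [integral_eval_mul F hF, integral_const_mul]

theorem opt_eq_bot {c : Alloc n → EReal} (hc : ∀ x, c x = ⊤) (v : Profile n) : opt c v = ⊥ := by
  simp [opt, allocWelfare, hc]

theorem bot_lt_opt {c : Alloc n → EReal} {x : Alloc n} (hx : c x ≠ ⊤) (v : Profile n) :
    ⊥ < opt c v := by
  refine lt_of_lt_of_le ?_ (le_iSup (allocWelfare c v) x)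
  rw [bot_lt_iff_ne_bot, allocWelfare, sub_eq_add_neg, Ne, EReal.add_eq_bot_iff, not_or]
  exact ⟨EReal.coe_ne_bot _, by simpa using hx⟩

/-- In `EReal` the value ⊥ absorbs under addition, so one infinitely costly outcome of positive
probability sinks the whole sum. -/
theorem real_eq_zero_of_algWelfare_ne_bot {c : Alloc n → EReal} {A : Algorithm n} {v : Profile n}
    (h : algWelfare c A v ≠ ⊥) {x : Alloc n} (hx : c x = ⊤) : (A v).real {x} = 0 := by
  by_contra h0
  have hpos : 0 < (A v).real {x} := lt_of_le_of_ne measureReal_nonneg (Ne.symm h0)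
  refine h ?_
  rw [algWelfare, ← Finset.add_sum_erase _ _ (Finset.mem_univ x), EReal.add_eq_bot_iff]
  left
  rw [allocWelfare, hx, EReal.sub_top, EReal.coe_mul_bot_of_pos hpos]

/-- An algorithm with the same ex-ante distribution of outcomes and a higher expected value of the
served agents inherits every worst-case guarantee on average. -/
theorem isBayesianApprox_of_isWorstCaseApprox (hF0 : ∀ i, F i (Iio 0) = 0)
    (hF : ∀ i, Integrable (fun t : ℝ => t) (F i)) {A B : Algorithm n} [IsMarkovKernel A]
    [IsMarkovKernel B] (hbind : (Measure.pi F).bind B = (Measure.pi F).bind A)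
    (hwel : ∀ i, ∫ t, t * interimAlloc F A i t ∂(F i) ≤ ∫ t, t * interimAlloc F B i t ∂(F i))
    {c : Alloc n → EReal} {β : ℝ} (hc : ∀ x, c x ≠ ⊥) (hβ : 0 < β)
    (hA : IsWorstCaseApprox c β A) : IsBayesianApprox c F β B := by
  rw [IsBayesianApprox, ← expectation_div hβ]
  by_cases hcx : ∃ x, c x ≠ ⊤
  swap
  · push Not at hcx
    refine expectation_mono (Filter.Eventually.of_forall fun v => ?_)
    rw [opt_eq_bot hcx, EReal.bot_div_of_pos_ne_top (EReal.coe_pos.2 hβ) (EReal.coe_ne_top _)]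
    exact bot_le
  obtain ⟨x₀, hx₀⟩ := hcx
  have hnn : ∀ᵐ v ∂(Measure.pi F), ∀ i, 0 ≤ v i := by
    refine ae_all_iff.2 fun i => ?_
    have : ∀ᵐ t ∂(F i), 0 ≤ t := by
      rw [ae_iff]; simpa [Iio_def] using hF0 i
    exact (measurePreserving_eval F i).quasiMeasurePreserving.ae this
  -- OPT exceeds -∞ once some cost is finite, so the guarantee keeps the welfare of A above -∞.
  have hAzero : ∀ v : Profile n, (∀ i, 0 ≤ v i) → ∀ x, c x = ⊤ → (A v).real {x} = 0 := by
    intro v hv x hx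
    refine real_eq_zero_of_algWelfare_ne_bot (fun hbot => ?_) hx
    have h1 := hA v hv
    rw [hbot, le_bot_iff, EReal.div_eq_inv_mul, EReal.mul_eq_bot] at h1
    have h2 := (bot_lt_opt hx₀ v).ne'
    have h3 : (0 : EReal) < (β : EReal)⁻¹ := by
      rw [← EReal.coe_inv]; exact EReal.coe_pos.2 (inv_pos.2 hβ)
    rcases h1 with h | h | h | h
    · exact not_lt_bot (h.1 ▸ h3)
    · exact h2 h.2
    · rw [← EReal.coe_inv] at h; exact EReal.coe_ne_top _ h.1
    · exact absurd h.1 (not_lt.2 h3.le)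
  have hlint : ∀ x, ∫⁻ v, B v {x} ∂(Measure.pi F) = ∫⁻ v, A v {x} ∂(Measure.pi F) := by
    intro x
    have := congrArg (fun ν : Measure (Alloc n) => ν {x}) hbind
    simpa only [Measure.bind_apply (measurableSet_singleton x) (Kernel.measurable _).aemeasurable]
      using this
  have hreal : ∀ (C : Algorithm n) [IsMarkovKernel C] (x : Alloc n),
      ∫ v, (C v).real {x} ∂(Measure.pi F) = (∫⁻ v, C v {x} ∂(Measure.pi F)).toReal :=
    fun C _ x => integral_toReal (measurable_kernel_apply C _).aemeasurable
      (Filter.Eventually.of_forall fun v => measure_lt_top _ _)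
  -- For B the exclusion of infinite costs holds only almost everywhere: it comes from the equality
  -- of ex-ante outcome probabilities.
  have hBzero : ∀ᵐ v ∂(Measure.pi F), ∀ x, c x = ⊤ → (B v).real {x} = 0 := by
    refine ae_all_iff.2 fun x => ?_
    by_cases hx : c x = ⊤
    swap
    · exact Filter.Eventually.of_forall fun v h => absurd h hx
    have h0 : ∫⁻ v, B v {x} ∂(Measure.pi F) = 0 := by
      rw [hlint, lintegral_eq_zero_iff (measurable_kernel_apply A _)]
      filter_upwards [hnn] with v hv
      exact (measureReal_eq_zero_iff).1 (hAzero v hv x hx)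
    rw [lintegral_eq_zero_iff (measurable_kernel_apply B _)] at h0
    filter_upwards [h0] with v hv _
    exact (measureReal_eq_zero_iff).2 hv
  -- `toReal` sends ⊤ to 0, which is harmless because such outcomes have probability zero at the
  -- profiles considered.
  set c' : Alloc n → ℝ := fun x => (c x).toReal
  calc expectation (Measure.pi F) (fun v => opt c v / (β : EReal))
      ≤ expectation (Measure.pi F) (fun v => (realWelfare c' A v : EReal)) := by
        refine expectation_mono ?_
        filter_upwards [hnn] with v hv
        rw [← algWelfare_eq_realWelfare hc (hAzero v hv)]
        exact hA v hv
    _ ≤ expectation (Measure.pi F) (fun v => (realWelfare c' B v : EReal)) := by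
        rw [expectation_coe (integrable_realWelfare F hF c' A),
          expectation_coe (integrable_realWelfare F hF c' B), EReal.coe_le_coe_iff,
          integral_realWelfare F hF, integral_realWelfare F hF]
        -- The expected costs become identical and only the values of the served agents remain to be
        -- compared.
        simp_rw [hreal, hlint]
        exact sub_le_sub_right (Finset.sum_le_sum fun i _ => hwel i) _
    _ ≤ expectation (Measure.pi F) (algWelfare c B) := by
        refine expectation_mono ?_
        filter_upwards [hBzero] with v hv
        rw [algWelfare_eq_realWelfare hc hv]

/-! ### The mechanism -/

/-- The payment rule `p(b) = b h(b) - ∫₀ᵇ h` of a monotone allocation rule is truthful. -/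
theorem utility_le_of_monotone {h : ℝ → ℝ} (hh : Monotone h) (v b : ℝ) :
    v * h b - (b * h b - ∫ z in (0 : ℝ)..b, h z) ≤
      v * h v - (v * h v - ∫ z in (0 : ℝ)..v, h z) := by
  have hint : ∀ a b, IntervalIntegrable h volume a b := fun a b => hh.intervalIntegrable
  have hsub := intervalIntegral.integral_interval_sub_left (hint 0 v) (hint 0 b)
  -- The gain from truth over bidding b is ∫ z in b..v, h z minus (v - b) * h b.
  have hle : (v - b) * h b ≤ ∫ z in b..v, h z := by
    rcases le_total b v with hbv | hvb
    · have := intervalIntegral.integral_mono_on hbv (intervalIntegrable_const (c := h b)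
        (μ := volume)) (hint b v) fun z hz => hh hz.1
      simpa using this
    · rw [intervalIntegral.integral_symm]
      have := intervalIntegral.integral_mono_on hvb (hint v b) (intervalIntegrable_const (c := h b)
        (μ := volume)) fun z hz => hh hz.2
      simp only [intervalIntegral.integral_const, smul_eq_mul] at this
      linarith
  linarith

/-- A full-measure measurable set admits a measurable retraction of the line onto it. -/
theorem exists_measurable_retraction (μ : Measure ℝ) [IsProbabilityMeasure μ] {D : Set ℝ}
    (hD : MeasurableSet D) (hμD : ∀ᵐ v ∂μ, v ∈ D) :
    ∃ r : ℝ → ℝ, Measurable r ∧ (∀ b, r b ∈ D) ∧ ∀ b ∈ D, r b = b := by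
  classical
  obtain ⟨d, hd⟩ := hμD.exists
  refine ⟨fun b => if b ∈ D then b else d, Measurable.ite hD measurable_id measurable_const,
    fun b => ?_, fun b hb => if_pos hb⟩
  by_cases hb : b ∈ D
  · simp [hb]
  · simpa [hb]

end Welfare

end SingleParam

theorem mainTheorem6 {n : ℕ} (F : Fin n → Measure ℝ) [∀ i, IsProbabilityMeasure (F i)]
    (hF_nonneg : ∀ i, F i (Iio 0) = 0)
    (hF_mean : ∀ i, Integrable (fun t : ℝ => t) (F i))
    (A : SingleParam.Algorithm n) [IsMarkovKernel A] :
    ∃ M : SingleParam.Mechanism n,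
      IsMarkovKernel M.alloc ∧
      SingleParam.IsIroningOf F A M.alloc ∧
      SingleParam.IsBIC F M ∧
      SingleParam.IsMonotoneWithPaymentIdentity F M ∧
      ∀ (c : SingleParam.Alloc n → EReal) (β : ℝ), (∀ x, c x ≠ ⊥) → 0 < β →
        SingleParam.IsWorstCaseApprox c β A →
        SingleParam.IsBayesianApprox c F β M.alloc := by
  open SingleParam in
  have hx := measurable_interimAlloc F A
  have h01 := interimAlloc_mem_Icc F A
  choose h hmono hh01 hae using fun i =>
    exists_monotone_ae_eq_ironedAlloc (μ := F i) (hx i) (h01 i)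
  -- Retraction onto the set where the ironed allocation equals `h i`, so that bids in the
  -- exceptional null set offer no profitable deviation.
  choose r hr hrD hrid using fun i => exists_measurable_retraction (F i)
    (measurableSet_eq_fun (measurable_ironedAlloc (μ := F i) (hx i) (h01 i))
      (hmono i).measurable) (hae i)
  have hrae : ∀ i, ∀ᵐ b ∂(F i), r i b = b := fun i => by
    filter_upwards [hae i] with b hb using hrid i b hb
  set κ : Fin n → ℝ → Measure ℝ := fun i b => redraw (F i) (interimAlloc F A i) (r i b) with hκ_def
  have hκp : ∀ i v, IsProbabilityMeasure (κ i v) := fun i v =>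
    isProbabilityMeasure_redraw (hx i) (h01 i) _
  have hκ : ∀ i, Measurable (κ i) := fun i => (measurable_redraw (hx i) (h01 i)).comp (hr i)
  have hinv : ∀ i, (F i).bind (κ i) = F i := fun i => by
    rw [Measure.bind_congr_right (g := redraw (F i) (interimAlloc F A i)),
      bind_redraw (hx i) (h01 i)]
    filter_upwards [hrae i] with b hb
    simp only [hκ_def, hb]
  let K : Kernel (Profile n) (Profile n) :=
    ⟨fun v => Measure.pi fun i => κ i (v i), measurable_pi_kernel hκ⟩
  have hK : IsMarkovKernel K := ⟨fun v => by
    change IsProbabilityMeasure (Measure.pi fun i => κ i (v i)); infer_instance⟩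
  have hB : ∀ v, (A ∘ₖ K) v = (Measure.pi fun i => κ i (v i)).bind A := fun v =>
    Kernel.comp_apply _ _ _
  have hinterim : ∀ i b, interimAlloc F (A ∘ₖ K) i b = h i (r i b) := by
    intro i b
    have h1 := ofReal_interimAlloc_of_bind F A (A ∘ₖ K) hκ hinv hB i b
    rw [hκ_def, ← ofReal_ironedAlloc (hx i) (h01 i)] at h1
    have h2 := (ENNReal.ofReal_eq_ofReal_iff (interimAlloc_mem_Icc F (A ∘ₖ K) i b).1
      (ironedAlloc_mem_Icc (hx i) (h01 i) _).1).1 h1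
    exact h2.trans (hrD i b)
  -- The payment depends on the agent's own bid alone, so its interim expectation is the payment
  -- itself.
  let p : Fin n → ℝ → ℝ := fun i b => r i b * h i (r i b) - ∫ z in (0 : ℝ)..(r i b), h i z
  let M : Mechanism n := ⟨A ∘ₖ K, fun v i => p i (v i)⟩
  have hpay : ∀ i b, interimPay F M i b = p i b := fun i b => by
    simp [interimPay, M]
  refine ⟨M, inferInstanceAs (IsMarkovKernel (A ∘ₖ K)), ⟨r, hr, hrae, hB⟩, fun i => ⟨fun b => ?_, ?_⟩,
    fun i => ⟨h i, hmono i, hh01 i, ?_⟩, fun c β hc hβ hA => ?_⟩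
  · simp only [M, Function.update_self]
    exact integrable_const _
  · filter_upwards [hrae i] with v hv b
    rw [hpay, hpay]
    change v * interimAlloc F (A ∘ₖ K) i b - _ ≤ v * interimAlloc F (A ∘ₖ K) i v - _
    rw [hinterim, hinterim]
    simp only [p, hv]
    -- Bidding b has the effect of bidding `r i b`, so every deviation is one within the monotone
    -- rule `h i`.
    exact utility_le_of_monotone (hmono i) v (r i b)
  · filter_upwards [hrae i] with v hv
    refine ⟨?_, ?_⟩
    · change interimAlloc F (A ∘ₖ K) i v = _
      rw [hinterim, hv]
    · rw [hpay]
      simp only [p, hv]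
  · refine isBayesianApprox_of_isWorstCaseApprox F hF_nonneg hF_mean ?_ (fun i => ?_) hc hβ hA
    · change (Measure.pi F).bind (A ∘ₖ K) = _
      -- The redrawn profile is again distributed as the product of the `F i`, so running A on it
      -- reproduces the ex-ante outcome law of A.
      have hbind : (Measure.pi F).bind K = Measure.pi F := by
        change (Measure.pi F).bind (fun v => Measure.pi fun i => κ i (v i)) = _
        rw [bind_pi F hκ]
        simp_rw [hinv]
      have hcomp : (⇑(A ∘ₖ K) : Profile n → Measure (Alloc n)) = fun v => (K v).bind A :=
        funext hB
      rw [hcomp, ← Measure.bind_bind K.measurable.aemeasurable A.measurable.aemeasurable, hbind]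
    · refine (integral_mul_le_integral_mul_ironedAlloc (hx i) (h01 i) (hF_nonneg i)
        (hF_mean i)).trans (le_of_eq (integral_congr_ae ?_))
      filter_upwards [hae i, hrae i] with v hv hrv
      change v * _ = v * interimAlloc F (A ∘ₖ K) i v
      rw [hinterim, hrv, hv]
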